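/- Let $N\ge 1$, $0<\sigma<1$, $s=1+\sigma$, and let $\Omega\subset\mathbb R^N$ be a bounded $C^{1,1}$ domain (a nonempty connected open set which near each boundary point is, in suitable orthonormal coordinates, the region below the graph of a $C^{1,1}$ function). Put $Q(\Omega)=\mathbb R^{2N}\setminus(\mathbb R^N\setminus\Omega)^2$, $c_{N,\sigma}=\Big(\int_{\mathbb R^N}\frac{1-\cos\xi_1}{|\xi|^{N+2\sigma}}\,d\xi\Big)^{-1}$, let $\mathcal P_1(\mathbb R^N)$ be the set of affine functions $p(x)=c_0+(c,x)$, and let $H$ be the space of the weakly differentiable functions $u:\mathbb R^N\to\mathbb R$ with $$\int_\Omega u^2\,dx+\iint_{Q(\Omega)}\frac{|\nabla u(x)-\nabla u(y)|^2}{|x-y|^{N+2\sigma}}\,dx\,dy<\infty .$$ An eigenfunction with eigenvalue $\lambda\in\mathbb R$ of the homogeneous Neumann problem $$(-\Delta)^s u=\lambda u\ \text{ in }\Omega,\qquad \mathcal N^1_\sigma u=0\ \text{ in }\mathbb R^N\setminus\overline\Omega,\qquad \mathcal N^2_\sigma u=0\ \text{ on }\partial\Omega$$ is a weak solution of it that does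 not vanish almost everywhere, that is, a function $u\in H$, not a.e. zero, with $$\frac{c_{N,\sigma}}2\iint_{Q(\Omega)}\frac{(\nabla u(x)-\nabla u(y))\cdot(\nabla v(x)-\nabla v(y))}{|x-y|^{N+2\sigma}}\,dx\,dy=\lambda\int_\Omega u\,v\,dx\qquad\text{for all }v\in H .$$ Theorem 5.1. The eigenvalues of this problem are exactly the terms of a nondecreasing sequence $$0=\lambda_1<\lambda_2\le\lambda_3\le\dots,\qquad \lim_{i\to\infty}\lambda_i=\infty .$$ The eigenfunctions with eigenvalue $\lambda_1=0$ are exactly the functions that are not a.e. zero and agree a.e. in $\mathbb R^N$ with an element of $\mathcal P_1(\mathbb R^N)$. Moreover there are eigenfunctions $u_{1,0},\dots,u_{1,N}\in\mathcal P_1(\mathbb R^N)$ with eigenvalue $\lambda_1$ and, for each $i\ge2$, an eigenfunction $u_i:\mathbb R^N\to\mathbb R$ with eigenvalue $\lambda_i$, such that the restrictions to $\Omega$ of $u_{1,0},\dots,u_{1,N},u_2,u_3,\dots$ form a complete orthogonal system of $L^2(\Omega)$ (nonzero, pairwise orthogonal, with dense linear span). -/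

import Mathlib

open MeasureTheory Filter Topology Set
open scoped ContDiff RealInnerProductSpace ENNReal

noncomputable section

/-- Euclidean space `ℝ^N`. -/
abbrev RN (N : ℕ) : Type := EuclideanSpace ℝ (Fin N)

/-- A `C^{1,1}` domain: a nonempty connected open set which, near each of its boundary points and
after the choice of a unit vector `e` ("the vertical direction"), is the region strictly below the
graph of a `C^{1,1}` function `γ` of the variables orthogonal to `e`. -/
structure IsC11Domain {N : ℕ} (Ω : Set (RN N)) : Prop where
  isOpen : IsOpen Ω
  isConnected : IsConnected Ω
  boundary : ∀ x₀ ∈ frontier Ω, ∃ r : ℝ, 0 < r ∧ ∃ e : RN N, ‖e‖ = 1 ∧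
    ∃ γ : (Submodule.span ℝ {e})ᗮ → ℝ,
      ContDiff ℝ 1 γ ∧ (∃ K : NNReal, LipschitzWith K (fderiv ℝ γ)) ∧
      ∀ x ∈ Metric.ball x₀ r,
        (x ∈ Ω ↔ ⟪x, e⟫ < γ ((Submodule.span ℝ {e})ᗮ.orthogonalProjectionOnto x))

/-- `U` is a weak gradient of `u` on `ℝ^N`: both are locally integrable, and
`∫ U_i φ = - ∫ u ∂_i φ` for all test functions `φ ∈ C_c^∞(ℝ^N)` and all `i`. -/
structure HasWeakGradient {N : ℕ} (u : RN N → ℝ) (U : RN N → RN N) : Prop where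
  locInt : LocallyIntegrable u volume
  locIntGrad : LocallyIntegrable U volume
  parts : ∀ φ : RN N → ℝ, ContDiff ℝ ∞ φ → HasCompactSupport φ → ∀ i : Fin N,
    ∫ x, U x i * φ x = - ∫ x, u x * fderiv ℝ φ x (EuclideanSpace.single i 1)

/-- `u` is weakly differentiable on `ℝ^N`. -/
def WeaklyDifferentiable {N : ℕ} (u : RN N → ℝ) : Prop :=
  ∃ U : RN N → RN N, HasWeakGradient u U

open Classical in
/-- The weak gradient of a weakly differentiable function (unique up to a null set); it is `0` by
convention if `u` is not weakly differentiable. -/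
def weakGradient {N : ℕ} (u : RN N → ℝ) : RN N → RN N :=
  if h : WeaklyDifferentiable u then h.choose else 0

/-- `Q(Ω) = ℝ^{2N} \ (ℝ^N \ Ω)²`. -/
def Qset {N : ℕ} (Ω : Set (RN N)) : Set (RN N × RN N) := (Ωᶜ ×ˢ Ωᶜ)ᶜ

/-- `D(u)² = ∬_{Q(Ω)} |∇u(x) - ∇u(y)|² / |x - y|^{N+2σ} dx dy`, as an extended number. -/
def energy {N : ℕ} (σ : ℝ) (Ω : Set (RN N)) (u : RN N → ℝ) : ℝ≥0∞ :=
  ∫⁻ z in Qset Ω, ENNReal.ofReal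
    (‖weakGradient u z.1 - weakGradient u z.2‖ ^ 2 / ‖z.1 - z.2‖ ^ ((N : ℝ) + 2 * σ))
    ∂((volume : Measure (RN N)).prod volume)

/-- `∬_{Q(Ω)} (∇u(x) - ∇u(y)) · (∇v(x) - ∇v(y)) / |x - y|^{N+2σ} dx dy`. -/
def energyForm {N : ℕ} (σ : ℝ) (Ω : Set (RN N)) (u v : RN N → ℝ) : ℝ :=
  ∫ z in Qset Ω,
    ⟪weakGradient u z.1 - weakGradient u z.2, weakGradient v z.1 - weakGradient v z.2⟫ /
      ‖z.1 - z.2‖ ^ ((N : ℝ) + 2 * σ)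
    ∂((volume : Measure (RN N)).prod volume)

/-- The normalization constant `c_{N,σ} = (∫_{ℝ^N} (1 - cos ξ₁) / |ξ|^{N+2σ} dξ)⁻¹`. -/
def cNσ (N : ℕ) [NeZero N] (σ : ℝ) : ℝ :=
  (∫ ξ : RN N, (1 - Real.cos (ξ 0)) / ‖ξ‖ ^ ((N : ℝ) + 2 * σ))⁻¹

/-- The energy space `H^s_{N(g₁,g₂)}(Ω)`, `s = 1 + σ`: the weakly differentiable `u : ℝ^N → ℝ` with
`∫_Ω u² + D(u)² + ∫_{ℝ^N \ Ω} |g₁| u² < ∞`. (It does not depend on `g₂`.) -/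
structure MemHsN {N : ℕ} (σ : ℝ) (Ω : Set (RN N)) (g₁ : RN N → ℝ) (u : RN N → ℝ) : Prop where
  weakDiff : WeaklyDifferentiable u
  energy_lt_top : energy σ Ω u < ⊤
  memLp : MemLp u 2 (volume.restrict Ω)
  integrable_ext : IntegrableOn (fun x => |g₁ x| * u x ^ 2) Ωᶜ

/-- The trace on `∂Ω` of a Sobolev function `v`, from inside `Ω`: at `x ∈ ∂Ω` it is the limit of the
averages of `v` over `B_r(x) ∩ Ω` as `r → 0⁺` (this limit exists and is the usual trace at almost
every boundary point of a regular domain). -/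
def boundaryTrace {N : ℕ} (Ω : Set (RN N)) (v : RN N → ℝ) (x : RN N) : ℝ :=
  limUnder (𝓝[>] (0 : ℝ)) fun r => ⨍ y in Metric.ball x r ∩ Ω, v y

/-- The surface measure `dS` on `∂Ω`. -/
def surfaceMeasure {N : ℕ} (Ω : Set (RN N)) : Measure (RN N) :=
  (Measure.euclideanHausdorffMeasure (N - 1) : Measure (RN N)).restrict (frontier Ω)

/-- `u` is a weak solution of the Neumann problem
`(-Δ)^s u = f` in `Ω`, `N¹_σ u = g₁` in `ℝ^N \ closure Ω`, `N²_σ u = g₂` on `∂Ω`, with `s = 1 + σ`: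
it lies in the energy space and satisfies the Green formula of the problem against every test
function `v` of the energy space. -/
def IsWeakSolution {N : ℕ} [NeZero N] (σ : ℝ) (Ω : Set (RN N)) (f g₁ g₂ : RN N → ℝ)
    (u : RN N → ℝ) : Prop :=
  MemHsN σ Ω g₁ u ∧ ∀ v : RN N → ℝ, MemHsN σ Ω g₁ v →
    cNσ N σ / 2 * energyForm σ Ω u v =
      (∫ x in Ω, f x * v x) + (∫ x in Ωᶜ, g₁ x * v x) +
        ∫ x, g₂ x * boundaryTrace Ω v x ∂(surfaceMeasure Ω)

/-- `u` is an eigenfunction, with eigenvalue `μ`, of the homogeneous Neumann problem: a weak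
solution of `(-Δ)^s u = μ u` in `Ω`, `N¹_σ u = 0`, `N²_σ u = 0` which is not zero a.e. -/
def IsNeumannEigenfunction {N : ℕ} [NeZero N] (σ : ℝ) (Ω : Set (RN N)) (μ : ℝ)
    (u : RN N → ℝ) : Prop :=
  IsWeakSolution σ Ω (fun x => μ * u x) 0 0 u ∧ ¬ u =ᵐ[volume] 0

/-- `μ` is an eigenvalue of the homogeneous Neumann problem. -/
def IsNeumannEigenvalue {N : ℕ} [NeZero N] (σ : ℝ) (Ω : Set (RN N)) (μ : ℝ) : Prop :=
  ∃ u : RN N → ℝ, IsNeumannEigenfunction σ Ω μ u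

/-- `p` belongs to `P₁(ℝ^N)`, that is, `p(x) = c₀ + (c, x)`. -/
def IsAffineFunction {N : ℕ} (p : RN N → ℝ) : Prop :=
  ∃ (c₀ : ℝ) (c : RN N), ∀ x, p x = c₀ + ⟪c, x⟫

/-- The restrictions to `Ω` of the functions `w i` form a complete orthogonal system of `L²(Ω)`:
they are nonzero and pairwise orthogonal elements of `L²(Ω)` with dense linear span. -/
def IsCompleteOrthogonalSystem {N : ℕ} {ι : Type*} (Ω : Set (RN N)) (w : ι → RN N → ℝ) : Prop :=
  ∃ hw : ∀ i, MemLp (w i) 2 (volume.restrict Ω),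
    (∀ i, (hw i).toLp ≠ 0) ∧
    (Pairwise fun i j => ⟪(hw i).toLp, (hw j).toLp⟫ = 0) ∧
    (Submodule.span ℝ (Set.range fun i => (hw i).toLp)).topologicalClosure = ⊤

end

/-! The problem becomes the spectral theorem for a compact operator. A function `u` of the energy
space, with gradient `U`, is encoded by the pair of `u` restricted to `Ω` and the weighted
difference `(U x - U y) / |x - y|^{(N+2σ)/2}` on `Q(Ω)`. These pairs form a subspace `V` of `L²(Ω) ×
L²(Q(Ω))` whose inner product is `∫_Ω u v` plus the energy form. With `T : V → L²(Ω)` the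
restriction, the weak equation with eigenvalue `μ` reads `⟪w, z⟫ = κ ⟪T w, T z⟫` for all `z`, where
`μ = c_{N,σ} (κ - 1) / 2` (`isNeumannEigenfunction_iff`). If `V` is complete and `T` is compact with
dense range, then `T T*` is a positive definite compact operator on `L²(Ω)` with eigenvalues `1/κ`,
and its eigenvectors span a dense subspace (`exists_variational_eigenbasis`). As `‖T‖ ≤ 1`, always
`κ ≥ 1`. Equality means zero energy, that is, an affine function.

The analysis rests on one observation: `Q(Ω)` contains `B × Ω` for every ball `B`. Where `|x - y|`
is bounded, so is the kernel from below, hence the energy controls `|U x - U y|²` on `B × Ω` and, by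
Jensen, the distance from `U` to a smooth average of `U` over `Ω`. Integration by parts bounds that
average by the `L²(Ω)` norm of `u`. So the energy norm controls `∇u` on every ball
(`exists_lintegral_gradient_le`) and, through the estimate of `u(x + h) - u(x)` by `∇u`, also `u`
itself (`exists_lintegral_le`).

Completeness follows by passing to limits on balls (`isClosed_energySpace`). Compactness follows by
replacing `u` with its means over finitely many `δ`-balls, with error `O(δ)` times the gradient on a
larger ball (`isCompactOperator_energyEmbedding`). The range is dense because test functions have
finite energy, which is where `0 < σ < 1` makes the kernel integrable at zero and at infinity. Zero
energy forces a constant gradient (`HasWeakGradient.exists_affine`). -/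

/-! ### Monotone enumeration of a discrete family of reals -/

theorem exists_equiv_nat_monotone {ι : Type*} [Infinite ι] (l : ι → ℝ)
    (h : ∀ c, {i | l i ≤ c}.Finite) : ∃ e : ℕ ≃ ι, Monotone fun n => l (e n) := by
  have hc : Countable ι := by
    rw [← Set.countable_univ_iff]
    refine (Set.countable_iUnion fun n : ℕ => (h n).countable).mono fun i _ => ?_
    obtain ⟨n, hn⟩ := exists_nat_ge (l i)
    exact Set.mem_iUnion.2 ⟨n, hn⟩
  obtain ⟨f, hf⟩ := hc.exists_injective_nat
  -- Ties of `l` are broken by the injection `f`. Each key then has finitely many predecessors, and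
  -- their number `r` is an injective rank; enumerating the range of `r` in order gives `e`.
  set key : ι → ℝ ×ₗ ℕ := fun i => toLex (l i, f i) with hkey
  have key_inj : Function.Injective key := fun i j hij => by
    have := congrArg (fun p => (ofLex p).2) hij
    exact hf this
  have hle : ∀ i j, key i ≤ key j → l i ≤ l j := fun i j hij => by
    rcases (Prod.Lex.le_iff.1 hij) with h1 | h1
    · exact h1.le
    · exact h1.1.le
  have hfin : ∀ i, {j | key j < key i}.Finite := fun i =>
    (h (l i)).subset fun j hj => hle j i (le_of_lt hj)
  set r : ι → ℕ := fun i => {j | key j < key i}.ncard with hr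
  have hlt : ∀ i j, key i < key j → r i < r j := fun i j hij => by
    refine Set.ncard_lt_ncard ⟨fun k hk => lt_trans hk hij, fun hs => ?_⟩ (hfin j)
    exact lt_irrefl (key i) (hs hij)
  have hinj : Function.Injective r := fun i j hij => by
    rcases lt_trichotomy (key i) (key j) with h1 | h1 | h1
    · exact absurd hij (hlt i j h1).ne
    · exact key_inj h1
    · exact absurd hij (hlt j i h1).ne'
  classical
  have : Infinite (Set.range r) := (Set.infinite_range_of_injective hinj).to_subtype
  refine ⟨(Nat.Subtype.orderIsoOfNat (Set.range r)).toEquiv.trans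
    (Equiv.ofInjective r hinj).symm, fun n m hnm => ?_⟩
  refine hle _ _ (not_lt.1 fun hcon => ?_)
  have h2 := hlt _ _ hcon
  simp only [Equiv.trans_apply, Equiv.apply_ofInjective_symm] at h2
  exact absurd ((Nat.Subtype.orderIsoOfNat (Set.range r)).monotone hnm) (not_le.2 h2)

/-! ### Compact positive operators: eigenvalues in sequence -/

section Spectral

variable {L : Type*} [NormedAddCommGroup L] [InnerProductSpace ℝ L]

/-- By orthogonality the images `T (b i)` with `m i ≥ ε` lie at mutual distance at least `ε`.
Infinitely many of them would be a sequence in a compact set with no Cauchy subsequence. -/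
theorem finite_of_orthonormal_eigenvectors {ι : Type*} {T : L →L[ℝ] L} (hT : IsCompactOperator T)
    {b : ι → L} (hb : Orthonormal ℝ b) {m : ι → ℝ} (hm : ∀ i, T (b i) = m i • b i)
    {ε : ℝ} (hε : 0 < ε) : {i | ε ≤ m i}.Finite := by
  by_contra hinf
  obtain ⟨K, hK, hsub⟩ :=
    IsCompactOperator.image_closedBall_subset_compact (f := T.toLinearMap) hT 1
  have hinf : {i | ε ≤ m i}.Infinite := hinf
  set a := hinf.natEmbedding with ha
  obtain ⟨x, -, φ, hφ, hlim⟩ := hK.tendsto_subseq (x := fun n => T (b (a n))) fun n =>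
    hsub ⟨b (a n), by simp [hb.1], rfl⟩
  have hC := hlim.cauchySeq
  rw [Metric.cauchySeq_iff] at hC
  obtain ⟨n, hn⟩ := hC ε hε
  have h1 := hn n le_rfl (n + 1) (Nat.le_succ n)
  have hne : (a (φ n) : ι) ≠ a (φ (n + 1)) := fun h =>
    (hφ (Nat.lt_succ_self n)).ne (a.injective (Subtype.ext h))
  simp only [Function.comp_apply, hm, dist_eq_norm] at h1
  have h2 : ‖m (a (φ n)) • b (a (φ n)) - m (a (φ (n + 1))) • b (a (φ (n + 1)))‖ ^ 2 =
      m (a (φ n)) ^ 2 + m (a (φ (n + 1))) ^ 2 := by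
    rw [norm_sub_sq_real, inner_smul_left, inner_smul_right, hb.2 hne]
    simp [norm_smul, hb.1]
  have h3 : ε ≤ m (a (φ n)) := (a (φ n)).2
  have h4 : ‖m (a (φ n)) • b (a (φ n)) - m (a (φ (n + 1))) • b (a (φ (n + 1)))‖ ^ 2 < ε ^ 2 :=
    pow_lt_pow_left₀ h1 (norm_nonneg _) two_ne_zero
  nlinarith [sq_nonneg (m (a (φ (n + 1))))]

/-- Spectral theorem for a positive definite compact operator on an infinite-dimensional Hilbert
space: apart from the eigenspace of one chosen value `κ`, the eigenvalues, repeated according to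
multiplicity, form a sequence decreasing to zero. -/
theorem exists_eigenbasis_nat [CompleteSpace L] (T : L →L[ℝ] L) (hT : IsCompactOperator T)
    (hs : T.toLinearMap.IsSymmetric) (hpos : ∀ x, x ≠ 0 → 0 < ⟪T x, x⟫)
    (hinf : ¬ FiniteDimensional ℝ L) {κ : ℝ} (hκ : κ ≠ 0) :
    ∃ (m : ℕ → ℝ) (b : ℕ → L), Orthonormal ℝ b ∧ (∀ i, T (b i) = m i • b i) ∧ (∀ i, 0 < m i) ∧
      (∀ i, m i ≠ κ) ∧ Antitone m ∧ Tendsto m atTop (𝓝 0) ∧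
      (∀ μ, μ ≠ κ → Module.End.HasEigenvalue T.toLinearMap μ → ∃ i, m i = μ) ∧
      (Submodule.span ℝ (Set.range b) ⊔
        Module.End.eigenspace T.toLinearMap κ).topologicalClosure = ⊤ := by
  have hpos' : ∀ μ, Module.End.HasEigenvalue T.toLinearMap μ → 0 < μ := fun μ hμ => by
    obtain ⟨v, hv⟩ := hμ.exists_hasEigenvector
    have h1 := hpos v hv.2
    have h2 : T v = μ • v := hv.apply_eq_smul
    rw [h2, inner_smul_left, real_inner_self_eq_norm_sq] at h1
    exact pos_of_mul_pos_left h1 (sq_nonneg _)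
  -- The value `κ` is left out of the index; its eigenspace returns only as a summand in the density
  -- statement.
  set J := {μ : ℝ // μ ≠ κ ∧ Module.End.HasEigenvalue T.toLinearMap μ}
  have hfd : ∀ μ : ℝ, μ ≠ 0 → FiniteDimensional ℝ (Module.End.eigenspace T.toLinearMap μ) :=
    fun μ hμ => T.finite_dimensional_eigenspace hT μ hμ
  have hfdJ : ∀ μ : J, FiniteDimensional ℝ (Module.End.eigenspace T.toLinearMap μ.1) :=
    fun μ => hfd _ (hpos' _ μ.2.2).ne'
  set ι := Σ μ : J, Fin (Module.finrank ℝ (Module.End.eigenspace T.toLinearMap μ.1))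
  set b : ι → L := fun i =>
    (stdOrthonormalBasis ℝ (Module.End.eigenspace T.toLinearMap i.1.1) i.2 : L) with hbdef
  have hb : Orthonormal ℝ b := by
    have h1 := (hs.orthogonalFamily_eigenspaces).comp (γ := J) (f := fun μ => μ.1)
      Subtype.val_injective
    exact h1.orthonormal_sigma_orthonormal
      (fun μ => (stdOrthonormalBasis ℝ (Module.End.eigenspace T.toLinearMap μ.1)).orthonormal)
  have hTb : ∀ i, T (b i) = i.1.1 • b i := fun i =>
    Module.End.mem_eigenspace_iff.1
      (stdOrthonormalBasis ℝ (Module.End.eigenspace T.toLinearMap i.1.1) i.2).2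
  have hmem : ∀ μ : J, Module.End.eigenspace T.toLinearMap μ.1 ≤
      Submodule.span ℝ (Set.range b) := fun μ x hx => by
    have h1 := (stdOrthonormalBasis ℝ (Module.End.eigenspace T.toLinearMap μ.1)).sum_repr ⟨x, hx⟩
    have h2 := congrArg Subtype.val h1
    simp only [Submodule.coe_sum, Submodule.coe_smul] at h2
    rw [← h2]
    exact Submodule.sum_mem _ fun k _ => Submodule.smul_mem _ _
      (Submodule.subset_span ⟨⟨μ, k⟩, rfl⟩)
  have hdense : (Submodule.span ℝ (Set.range b) ⊔
      Module.End.eigenspace T.toLinearMap κ).topologicalClosure = ⊤ := by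
    rw [Submodule.topologicalClosure_eq_top_iff, eq_bot_iff,
      ← T.orthogonalComplement_iSup_eigenspaces_eq_bot hT hs]
    refine Submodule.orthogonal_le (iSup_le fun μ => ?_)
    by_cases h1 : μ = κ
    · rw [h1]; exact le_sup_right
    by_cases h2 : Module.End.HasEigenvalue T.toLinearMap μ
    · exact (hmem ⟨μ, h1, h2⟩).trans le_sup_left
    · rw [Module.End.hasEigenvalue_iff, not_not] at h2
      rw [show Module.End.eigenspace (T : Module.End ℝ L) μ = ⊥ from h2]; exact bot_le
  -- With finitely many basis vectors the dense sum would be finite-dimensional, hence closed, hence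
  -- all of `L`.
  have hinfι : Infinite ι := by
    by_contra hfin
    rw [not_infinite_iff_finite] at hfin
    apply hinf
    have := hfd κ hκ
    have : FiniteDimensional ℝ (Submodule.span ℝ (Set.range b)) :=
      FiniteDimensional.span_of_finite ℝ (Set.finite_range b)
    have h1 : FiniteDimensional ℝ ↥(Submodule.span ℝ (Set.range b) ⊔
      Module.End.eigenspace T.toLinearMap κ) := inferInstance
    rw [(Submodule.closed_of_finiteDimensional _).submodule_topologicalClosure_eq] at hdense
    rw [hdense] at h1
    exact Module.Finite.equiv (Submodule.topEquiv (R := ℝ) (M := L))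
  have hfinle : ∀ ε : ℝ, 0 < ε → {i : ι | ε ≤ i.1.1}.Finite := fun ε hε =>
    finite_of_orthonormal_eigenvectors hT hb (m := fun i => i.1.1) hTb hε
  have hp : ∀ i : ι, 0 < i.1.1 := fun i => hpos' _ i.1.2.2
  -- Decreasing eigenvalues are increasing reciprocals. The bound `|c| + 1` is positive whatever the
  -- sign of `c`.
  obtain ⟨e, he⟩ := exists_equiv_nat_monotone (fun i : ι => (i.1.1)⁻¹) fun c => by
    refine (hfinle (1 / (|c| + 1)) (by positivity)).subset fun i hi => ?_
    have h1 : (i.1.1)⁻¹ ≤ |c| + 1 := (le_trans hi (le_abs_self c)).trans (by linarith)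
    have := inv_anti₀ (inv_pos.2 (hp i)) h1
    simpa using this
  have hanti : Antitone fun n => (e n).1.1 := fun n k hnk =>
    (inv_le_inv₀ (hp _) (hp _)).1 (he hnk)
  refine ⟨fun n => (e n).1.1, fun n => b (e n), hb.comp e e.injective, fun n => hTb _,
    fun n => hp _, fun n => (e n).1.2.1, hanti, ?_, fun μ h1 h2 => ?_, ?_⟩
  · rw [Metric.tendsto_atTop]
    intro ε hε
    have hf := (hfinle ε hε).preimage (f := e) e.injective.injOn
    obtain ⟨n, hn⟩ := hf.bddAbove
    refine ⟨n + 1, fun k hk => ?_⟩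
    rw [Real.dist_eq, sub_zero, abs_of_pos (hp _)]
    by_contra hcon
    exact absurd (hn (show k ∈ _ from not_lt.1 hcon)) (by omega)
  · have := hfdJ ⟨μ, h1, h2⟩
    have hpos : 0 < Module.finrank ℝ (Module.End.eigenspace T.toLinearMap μ) := by
      rw [Module.finrank_pos_iff]
      exact Submodule.nontrivial_iff_ne_bot.2 (Module.End.hasEigenvalue_iff.1 h2)
    exact ⟨e.symm ⟨⟨μ, h1, h2⟩, ⟨0, hpos⟩⟩, by simp⟩
  · rwa [show (fun n => b (e n)) = b ∘ e from rfl, e.surjective.range_comp]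

end Spectral

/-! ### Square integrals and Jensen's inequality -/

section Jensen

variable {α : Type*} [MeasurableSpace α] {P : Measure α}

theorem eLpNorm_two_sq {G : Type*} [NormedAddCommGroup G] (f : α → G) (μ : Measure α) :
    eLpNorm f 2 μ ^ 2 = ∫⁻ x, ‖f x‖ₑ ^ 2 ∂μ := by
  have h := eLpNorm_nnreal_pow_eq_lintegral (μ := μ) (f := f) (p := 2) two_ne_zero
  simpa using h

theorem memLp_two_iff_lintegral {G : Type*} [NormedAddCommGroup G] {f : α → G} {μ : Measure α}
    (hf : AEStronglyMeasurable f μ) : MemLp f 2 μ ↔ ∫⁻ x, ‖f x‖ₑ ^ 2 ∂μ < ⊤ := by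
  rw [← eLpNorm_two_sq]
  refine ⟨fun h => ENNReal.pow_lt_top h.2, fun h => ⟨hf, ?_⟩⟩
  by_contra hcon
  rw [not_lt, top_le_iff] at hcon
  simp [hcon] at h

theorem sq_lintegral_le [IsProbabilityMeasure P] {f : α → ℝ≥0∞} (hf : AEMeasurable f P) :
    (∫⁻ x, f x ∂P) ^ 2 ≤ ∫⁻ x, f x ^ 2 ∂P := by
  have h := ENNReal.lintegral_mul_le_Lp_mul_Lq P Real.HolderConjugate.two_two hf
    (g := fun _ => 1) aemeasurable_const
  simp only [Pi.mul_apply, mul_one, ENNReal.rpow_two, one_pow, lintegral_one, measure_univ,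
    ENNReal.one_rpow] at h
  calc (∫⁻ x, f x ∂P) ^ 2 ≤ ((∫⁻ x, f x ^ 2 ∂P) ^ (1 / 2 : ℝ)) ^ 2 := by gcongr
    _ = _ := by rw [← ENNReal.rpow_natCast, ← ENNReal.rpow_mul]; norm_num

/-- Jensen for the square. It trades the deviation from a mean for an integral of differences, which
is the quantity that energies and translations control. -/
theorem enorm_sub_integral_sq_le [IsProbabilityMeasure P] {G : Type*} [NormedAddCommGroup G]
    [NormedSpace ℝ G] [CompleteSpace G] {F : α → G} (hF : Integrable F P) (a : G) :
    ‖a - ∫ y, F y ∂P‖ₑ ^ 2 ≤ ∫⁻ y, ‖a - F y‖ₑ ^ 2 ∂P := by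
  have h1 : a - ∫ y, F y ∂P = ∫ y, (a - F y) ∂P := by
    rw [integral_sub (integrable_const a) hF]; simp
  rw [h1]
  calc ‖∫ y, (a - F y) ∂P‖ₑ ^ 2 ≤ (∫⁻ y, ‖a - F y‖ₑ ∂P) ^ 2 := by
        gcongr; exact enorm_integral_le_lintegral_enorm _
    _ ≤ _ := sq_lintegral_le (aestronglyMeasurable_const.sub hF.1).enorm

theorem enorm_sq_le_two_mul {G : Type*} [NormedAddCommGroup G] (a b : G) :
    ‖a‖ₑ ^ 2 ≤ 2 * ‖a - b‖ₑ ^ 2 + 2 * ‖b‖ₑ ^ 2 := by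
  have h : ‖a‖ₑ ≤ ‖a - b‖ₑ + ‖b‖ₑ := by simpa using enorm_add_le (a - b) b
  have h2 : (‖a - b‖ₑ + ‖b‖ₑ) ^ 2 ≤ 2 * ‖a - b‖ₑ ^ 2 + 2 * ‖b‖ₑ ^ 2 := by
    have := ENNReal.rpow_add_le_mul_rpow_add_rpow ‖a - b‖ₑ ‖b‖ₑ (p := 2) (by norm_num)
    norm_num at this
    simpa [mul_add] using this
  exact (by gcongr : ‖a‖ₑ ^ 2 ≤ _).trans h2

end Jensen

/-! ### Calculus of weak gradients -/

section WeakGradient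

variable {N : ℕ} {u v : RN N → ℝ} {U V : RN N → RN N}

theorem LocallyIntegrable.integrable_mul_compactSupport {f φ : RN N → ℝ}
    (hf : LocallyIntegrable f volume) (hφ : Continuous φ) (hc : HasCompactSupport φ) :
    Integrable (fun x => f x * φ x) volume := by
  simpa [mul_comm] using hf.integrable_smul_left_of_hasCompactSupport hφ hc

theorem LocallyIntegrable.inner_const {F : RN N → RN N} (hF : LocallyIntegrable F volume)
    (h : RN N) : LocallyIntegrable (fun x => ⟪F x, h⟫) volume := by
  intro x
  obtain ⟨s, hs, hi⟩ := hF x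
  exact ⟨s, hs, Integrable.inner_const hi h⟩

theorem LocallyIntegrable.coord {F : RN N → RN N} (hF : LocallyIntegrable F volume)
    (i : Fin N) : LocallyIntegrable (fun x => F x i) volume := by
  have := LocallyIntegrable.inner_const hF (EuclideanSpace.single i 1)
  simpa [EuclideanSpace.inner_single_right] using this

theorem continuous_fderiv_apply_of_test {φ : RN N → ℝ} (hφ : ContDiff ℝ ∞ φ) (h : RN N) :
    Continuous fun x => fderiv ℝ φ x h :=
  (hφ.continuous_fderiv (by simp)).clm_apply continuous_const

theorem contDiff_fderiv_apply_of_test {φ : RN N → ℝ} (hφ : ContDiff ℝ ∞ φ) (h : RN N) :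
    ContDiff ℝ ∞ fun x => fderiv ℝ φ x h :=
  (hφ.fderiv_right (m := ∞) (by simp)).clm_apply contDiff_const

theorem HasWeakGradient.congr (hu : HasWeakGradient u U) (h1 : u =ᵐ[volume] v)
    (h2 : U =ᵐ[volume] V) : HasWeakGradient v V where
  locInt := hu.locInt.congr h1
  locIntGrad := hu.locIntGrad.congr h2
  parts φ hφ hc i := by
    have e1 : ∫ x, V x i * φ x = ∫ x, U x i * φ x :=
      integral_congr_ae (by filter_upwards [h2] with x hx; rw [hx])
    have e2 : ∫ x, v x * fderiv ℝ φ x (EuclideanSpace.single i 1) =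
        ∫ x, u x * fderiv ℝ φ x (EuclideanSpace.single i 1) :=
      integral_congr_ae (by filter_upwards [h1] with x hx; rw [hx])
    rw [e1, e2, hu.parts φ hφ hc i]

theorem HasWeakGradient.add (hu : HasWeakGradient u U) (hv : HasWeakGradient v V) :
    HasWeakGradient (u + v) (U + V) where
  locInt := hu.locInt.add hv.locInt
  locIntGrad := hu.locIntGrad.add hv.locIntGrad
  parts φ hφ hc i := by
    have hd := continuous_fderiv_apply_of_test hφ (EuclideanSpace.single i 1)
    have hdc : HasCompactSupport fun x => fderiv ℝ φ x (EuclideanSpace.single i 1) :=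
      hc.fderiv_apply ℝ _
    simp only [Pi.add_apply, PiLp.add_apply, add_mul]
    rw [integral_add
        (LocallyIntegrable.integrable_mul_compactSupport
          (LocallyIntegrable.coord hu.locIntGrad i) hφ.continuous hc)
        (LocallyIntegrable.integrable_mul_compactSupport
          (LocallyIntegrable.coord hv.locIntGrad i) hφ.continuous hc),
      integral_add (LocallyIntegrable.integrable_mul_compactSupport hu.locInt hd hdc)
        (LocallyIntegrable.integrable_mul_compactSupport hv.locInt hd hdc),
      hu.parts φ hφ hc i, hv.parts φ hφ hc i]
    ring

theorem HasWeakGradient.smul (hu : HasWeakGradient u U) (c : ℝ) :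
    HasWeakGradient (c • u) (c • U) where
  locInt := hu.locInt.smul c
  locIntGrad := hu.locIntGrad.smul c
  parts φ hφ hc i := by
    simp only [Pi.smul_apply, PiLp.smul_apply, smul_eq_mul, mul_assoc]
    rw [integral_const_mul, integral_const_mul, hu.parts φ hφ hc i]
    ring

theorem HasWeakGradient.sub (hu : HasWeakGradient u U) (hv : HasWeakGradient v V) :
    HasWeakGradient (u - v) (U - V) := by
  have := hu.add (hv.smul (-1))
  simpa [sub_eq_add_neg] using this

/-- Both gradients have the same integral against every test function, so the fundamental lemma
applies to each coordinate. -/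
theorem HasWeakGradient.ae_unique (hu : HasWeakGradient u U) (hv : HasWeakGradient v V)
    (h : u =ᵐ[volume] v) : U =ᵐ[volume] V := by
  have hv' := hv.congr h.symm (ae_eq_refl V)
  have key : ∀ i : Fin N, ∀ᵐ x, U x i = V x i := fun i => by
    refine ae_eq_of_integral_contDiff_smul_eq (LocallyIntegrable.coord hu.locIntGrad i)
      (LocallyIntegrable.coord hv.locIntGrad i) fun φ hφ hc => ?_
    have := (hu.parts φ hφ hc i).trans (hv'.parts φ hφ hc i).symm
    simpa [mul_comm] using this
  filter_upwards [ae_all_iff.2 key] with x hx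
  ext i
  exact hx i

theorem WeaklyDifferentiable.hasWeakGradient (h : WeaklyDifferentiable u) :
    HasWeakGradient u (weakGradient u) := by
  rw [weakGradient, dif_pos h]
  exact h.choose_spec

/-- `weakGradient` is an arbitrary choice; this allows replacing it by whatever weak gradient is at
hand. -/
theorem HasWeakGradient.weakGradient_ae (h : HasWeakGradient u U) :
    weakGradient u =ᵐ[volume] U :=
  (WeaklyDifferentiable.hasWeakGradient ⟨U, h⟩).ae_unique h (ae_eq_refl u)

theorem hasWeakGradient_of_contDiff (hu : ContDiff ℝ ∞ u) :
    HasWeakGradient u fun x => gradient u x := by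
  have hcont : Continuous (gradient u) := by
    have := hu.continuous_fderiv (by simp)
    exact (InnerProductSpace.toDual ℝ (RN N)).symm.continuous.comp this
  refine ⟨hu.continuous.locallyIntegrable, hcont.locallyIntegrable, fun φ hφ hc i => ?_⟩
  have e : ∀ x, (gradient u x) i = fderiv ℝ u x (EuclideanSpace.single i 1) := fun x => by
    have : ⟪gradient u x, EuclideanSpace.single i (1 : ℝ)⟫ =
        fderiv ℝ u x (EuclideanSpace.single i 1) := by
      rw [gradient]; exact InnerProductSpace.toDual_symm_apply
    rw [← this, EuclideanSpace.inner_single_right]; simp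
  simp only [e]
  have hd := continuous_fderiv_apply_of_test hφ (EuclideanSpace.single i 1)
  have hdc : HasCompactSupport fun x => fderiv ℝ φ x (EuclideanSpace.single i 1) :=
    hc.fderiv_apply ℝ _
  rw [integral_mul_fderiv_eq_neg_fderiv_mul_of_integrable, neg_neg]
  · exact LocallyIntegrable.integrable_mul_compactSupport
      (continuous_fderiv_apply_of_test hu _).locallyIntegrable hφ.continuous hc
  · exact LocallyIntegrable.integrable_mul_compactSupport hu.continuous.locallyIntegrable hd hdc
  · exact LocallyIntegrable.integrable_mul_compactSupport hu.continuous.locallyIntegrable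
      hφ.continuous hc
  · exact fun x _ => (hu.differentiable (by simp)) x
  · exact fun x _ => (hφ.differentiable (by simp)) x

theorem HasWeakGradient.parts_inner (hu : HasWeakGradient u U) {φ : RN N → ℝ}
    (hφ : ContDiff ℝ ∞ φ) (hc : HasCompactSupport φ) (h : RN N) :
    ∫ x, ⟪U x, h⟫ * φ x = - ∫ x, u x * fderiv ℝ φ x h := by
  have e1 : ∀ x, ⟪U x, h⟫ * φ x = ∑ i, h i * (U x i * φ x) := fun x => by
    rw [PiLp.inner_apply, Finset.sum_mul]
    exact Finset.sum_congr rfl fun i _ => by simp; ring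
  have hh : h = ∑ i, h i • EuclideanSpace.single i (1 : ℝ) := by
    have := (EuclideanSpace.basisFun (Fin N) ℝ).sum_repr h
    simpa using this.symm
  have e2 : ∀ x, u x * fderiv ℝ φ x h =
      ∑ i, h i * (u x * fderiv ℝ φ x (EuclideanSpace.single i 1)) := fun x => by
    conv_lhs => rw [hh]
    rw [map_sum, Finset.mul_sum]
    exact Finset.sum_congr rfl fun i _ => by simp; ring
  simp only [e1, e2]
  rw [integral_finsetSum, integral_finsetSum, ← Finset.sum_neg_distrib]
  · exact Finset.sum_congr rfl fun i _ => by
      rw [integral_const_mul, integral_const_mul, hu.parts φ hφ hc i]; ring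
  · exact fun i _ => (LocallyIntegrable.integrable_mul_compactSupport hu.locInt
      (continuous_fderiv_apply_of_test hφ _) (hc.fderiv_apply ℝ _)).const_mul _
  · exact fun i _ => (LocallyIntegrable.integrable_mul_compactSupport
      (LocallyIntegrable.coord hu.locIntGrad i) hφ.continuous hc).const_mul _

end WeakGradient

/-! ### Translation estimate for weakly differentiable functions -/

section Translation

variable {N : ℕ} {u : RN N → ℝ} {U : RN N → RN N}

theorem HasCompactSupport.exists_ball {φ : RN N → ℝ} (hc : HasCompactSupport φ) :
    ∃ R : ℝ, 0 < R ∧ ∀ x, R ≤ ‖x‖ → φ x = 0 := by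
  obtain ⟨R, hR⟩ := hc.isCompact.isBounded.subset_ball_lt 0 0
  refine ⟨R, hR.1, fun x hx => image_eq_zero_of_notMem_tsupport fun hx' => ?_⟩
  have := hR.2 hx'
  rw [mem_ball_zero_iff] at this
  linarith

theorem HasCompactSupport.exists_bound {φ : RN N → ℝ} (hφ : Continuous φ)
    (hc : HasCompactSupport φ) : ∃ C : ℝ, 0 ≤ C ∧ ∀ x, |φ x| ≤ C := by
  obtain ⟨C, hC⟩ := hc.exists_bound_of_continuous hφ
  exact ⟨C, (norm_nonneg _).trans (hC 0), hC⟩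

/-- With the translation placed on the smooth factor, local integrability of `u` suffices to
differentiate under the integral. -/
theorem hasDerivAt_integral_translate (hu : LocallyIntegrable u volume) {φ : RN N → ℝ}
    (hφ : ContDiff ℝ ∞ φ) (hc : HasCompactSupport φ) (h : RN N) (t₀ : ℝ) :
    HasDerivAt (fun t : ℝ => ∫ x, u x * φ (x - t • h))
      (- ∫ x, u x * fderiv ℝ φ (x - t₀ • h) h) t₀ := by
  have hψ := continuous_fderiv_apply_of_test hφ h
  have hψc : HasCompactSupport fun x => fderiv ℝ φ x h := hc.fderiv_apply ℝ _
  obtain ⟨R, hR, hR0⟩ := HasCompactSupport.exists_ball hψc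
  obtain ⟨C, hC, hCb⟩ := HasCompactSupport.exists_bound hψ hψc
  -- This ball contains the support of the derivative of `φ` translated by `t • h` for every `t`
  -- with `|t - t₀| < 1`, so `C |u|` on it dominates.
  set K := Metric.closedBall (0 : RN N) (R + (|t₀| + 1) * ‖h‖)
  have key := hasDerivAt_integral_of_dominated_loc_of_deriv_le (μ := (volume : Measure (RN N)))
    (F := fun (t : ℝ) x => u x * φ (x - t • h)) (x₀ := t₀) (s := Metric.ball t₀ 1)
    (F' := fun t x => - (u x * fderiv ℝ φ (x - t • h) h))
    (bound := K.indicator fun x => C * |u x|)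
    (Metric.ball_mem_nhds _ one_pos) ?_ ?_ ?_ ?_ ?_ ?_
  · simpa [integral_neg] using key.2
  · exact Filter.Eventually.of_forall fun t => hu.aestronglyMeasurable.mul
      (hφ.continuous.comp (continuous_id.sub continuous_const)).aestronglyMeasurable
  · exact LocallyIntegrable.integrable_mul_compactSupport hu
      (hφ.continuous.comp (continuous_id.sub continuous_const))
      (hc.comp_homeomorph (Homeomorph.subRight (t₀ • h)))
  · exact (hu.aestronglyMeasurable.mul
      (hψ.comp (continuous_id.sub continuous_const)).aestronglyMeasurable).neg
  · refine Filter.Eventually.of_forall fun x t ht => ?_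
    rw [norm_neg, norm_mul, Real.norm_eq_abs, Real.norm_eq_abs]
    by_cases hx : x ∈ K
    · rw [Set.indicator_of_mem hx, mul_comm]
      exact mul_le_mul_of_nonneg_right (hCb _) (abs_nonneg _)
    · rw [Set.indicator_of_notMem hx]
      have h1 : R ≤ ‖x - t • h‖ := by
        rw [mem_closedBall_zero_iff, not_le] at hx
        have h2 := norm_sub_norm_le x (t • h)
        rw [norm_smul, Real.norm_eq_abs] at h2
        have h3 : |t| ≤ |t₀| + 1 := by
          rw [Metric.mem_ball, Real.dist_eq] at ht
          have := abs_sub_abs_le_abs_sub t t₀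
          linarith
        have := mul_le_mul_of_nonneg_right h3 (norm_nonneg h)
        linarith
      rw [hR0 _ h1]; simp
  · refine IntegrableOn.integrable_indicator ?_ measurableSet_closedBall
    exact ((hu.integrableOn_isCompact (isCompact_closedBall _ _)).abs).const_mul C
  · refine Filter.Eventually.of_forall fun x t _ => ?_
    have h1 : HasDerivAt (fun t : ℝ => x - t • h) (-h) t := by
      simpa using ((hasDerivAt_id t).smul_const h).const_sub x
    have h2 := ((hφ.differentiable (by simp)) (x - t • h)).hasFDerivAt.comp_hasDerivAt t h1
    simpa using h2.const_mul (u x)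

/-- The tested form of `u(x + h) - u(x) = ∫₀¹ ⟪U(x + t h), h⟫ dt`: the fundamental theorem of
calculus for `t ↦ ∫ u(x) φ(x - t h) dx`, whose derivative is rewritten by parts. -/
theorem HasWeakGradient.integral_translate (hu : HasWeakGradient u U) {φ : RN N → ℝ}
    (hφ : ContDiff ℝ ∞ φ) (hc : HasCompactSupport φ) (h : RN N) :
    ∫ x, (u (x + h) - u x) * φ x =
      ∫ t in (0 : ℝ)..1, ∫ x, ⟪U (x + t • h), h⟫ * φ x := by
  have hd := hasDerivAt_integral_translate hu.locInt hφ hc h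
  have hcont : Continuous fun t : ℝ => - ∫ x, u x * fderiv ℝ φ (x - t • h) h :=
    (continuous_iff_continuousAt.2 fun t => (hasDerivAt_integral_translate hu.locInt
      (contDiff_fderiv_apply_of_test hφ h) (hc.fderiv_apply ℝ h) h t).continuousAt).neg
  have hFTC := intervalIntegral.integral_eq_sub_of_hasDerivAt (a := 0) (b := 1)
    (fun t _ => hd t) (hcont.intervalIntegrable _ _)
  have e1 : ∀ t : ℝ, - ∫ x, u x * fderiv ℝ φ (x - t • h) h = ∫ x, ⟪U (x + t • h), h⟫ * φ x :=
    fun t => by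
      have hφt : ContDiff ℝ ∞ fun x => φ (x - t • h) := hφ.comp (contDiff_id.sub contDiff_const)
      have hct : HasCompactSupport fun x => φ (x - t • h) :=
        hc.comp_homeomorph (Homeomorph.subRight (t • h))
      have := hu.parts_inner hφt hct h
      simp only [fderiv_comp_sub] at this
      rw [← this, ← integral_add_right_eq_self _ (t • h)]
      simp
  rw [show (fun t : ℝ => - ∫ x, u x * fderiv ℝ φ (x - t • h) h) = _ from funext e1] at hFTC
  rw [hFTC]
  have e2 : ∫ x, u x * φ (x - (1 : ℝ) • h) = ∫ x, u (x + h) * φ x := by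
    rw [← integral_add_right_eq_self _ h]; simp
  rw [e2]
  simp only [zero_smul, sub_zero, sub_mul]
  rw [integral_sub]
  · have := LocallyIntegrable.integrable_mul_compactSupport hu.locInt
      (hφ.continuous.comp (continuous_id.sub continuous_const))
      (hc.comp_homeomorph (Homeomorph.subRight h))
    have := this.comp_add_right h
    simpa using this
  · exact LocallyIntegrable.integrable_mul_compactSupport hu.locInt hφ.continuous hc

theorem lintegral_ball_translate_le (f : RN N → ℝ≥0∞) (R : ℝ) {h : RN N} {t : ℝ}
    (ht : |t| ≤ 1) :
    ∫⁻ x in Metric.ball 0 R, f (x + t • h) ≤ ∫⁻ x in Metric.ball 0 (R + ‖h‖), f x := by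
  rw [← lintegral_indicator Metric.isOpen_ball.measurableSet,
    ← lintegral_indicator Metric.isOpen_ball.measurableSet,
    ← lintegral_add_right_eq_self ((Metric.ball 0 (R + ‖h‖)).indicator f) (t • h)]
  refine lintegral_mono fun x => ?_
  by_cases hx : x ∈ Metric.ball 0 R
  · have hx' : x + t • h ∈ Metric.ball 0 (R + ‖h‖) := by
      rw [mem_ball_zero_iff] at hx ⊢
      have h1 := norm_add_le x (t • h)
      rw [norm_smul, Real.norm_eq_abs] at h1
      have h2 := mul_le_mul_of_nonneg_right ht (norm_nonneg h)
      linarith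
    rw [Set.indicator_of_mem hx, Set.indicator_of_mem hx']
  · rw [Set.indicator_of_notMem hx]; exact bot_le

theorem HasWeakGradient.integrable_translate_prod (hu : HasWeakGradient u U) (hU : Measurable U)
    (h : RN N) (R : ℝ) :
    Integrable (fun z : ℝ × RN N => ⟪U (z.2 + z.1 • h), h⟫)
      ((volume.restrict (Set.Ioc (0 : ℝ) 1)).prod (volume.restrict (Metric.ball 0 R))) := by
  have hm : Measurable fun z : ℝ × RN N => ⟪U (z.2 + z.1 • h), h⟫ :=
    (hU.comp (by fun_prop)).inner measurable_const
  refine ⟨hm.aestronglyMeasurable, ?_⟩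
  rw [HasFiniteIntegral, lintegral_prod _ hm.enorm.aemeasurable]
  have hfin : ∫⁻ x in Metric.ball 0 (R + ‖h‖), ‖⟪U x, h⟫‖ₑ < ⊤ :=
    (((LocallyIntegrable.inner_const hu.locIntGrad h).integrableOn_isCompact
      (isCompact_closedBall 0 (R + ‖h‖))).mono_set Metric.ball_subset_closedBall).2
  refine lt_of_le_of_lt (b := ∫⁻ _ in Set.Ioc (0 : ℝ) 1,
    ∫⁻ x in Metric.ball 0 (R + ‖h‖), ‖⟪U x, h⟫‖ₑ) (setLIntegral_mono' measurableSet_Ioc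
      fun t ht => ?_) (by simpa using hfin)
  exact lintegral_ball_translate_le (fun x => ‖⟪U x, h⟫‖ₑ) R
    (abs_le.2 ⟨by linarith [ht.1], ht.2⟩)

/-- Fubini moves the `t`-integral inside the tested identity, and the fundamental lemma then removes
the test function. -/
theorem HasWeakGradient.translate_ae (hu : HasWeakGradient u U) (hU : Measurable U) (h : RN N) :
    ∀ᵐ x, u (x + h) - u x = ∫ t in Set.Ioc (0 : ℝ) 1, ⟪U (x + t • h), h⟫ := by
  refine ae_eq_of_integral_contDiff_smul_eq ?_ ?_ fun φ hφ hc => ?_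
  · refine LocallyIntegrable.sub (fun x => ?_) hu.locInt
    obtain ⟨s, hs, hi⟩ := hu.locInt (x + h)
    refine ⟨(fun y => y + h) ⁻¹' s, (continuous_add_const h).continuousAt hs, ?_⟩
    have := (measurePreserving_add_right (volume : Measure (RN N)) h).integrableOn_comp_preimage
      (measurableEmbedding_addRight h) (f := u) (s := s)
    exact this.2 hi
  · intro x
    refine ⟨Metric.ball 0 (‖x‖ + 1), Metric.isOpen_ball.mem_nhds (by simp), ?_⟩
    exact (hu.integrable_translate_prod hU h (‖x‖ + 1)).integral_prod_right
  · obtain ⟨R, hR, hR0⟩ := HasCompactSupport.exists_ball hc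
    obtain ⟨C, hC, hCb⟩ := HasCompactSupport.exists_bound hφ.continuous hc
    have hres : ∀ f : RN N → ℝ, ∫ x, f x * φ x = ∫ x in Metric.ball 0 R, f x * φ x := fun f => by
      refine (setIntegral_eq_integral_of_forall_compl_eq_zero fun x hx => ?_).symm
      rw [mem_ball_zero_iff, not_lt] at hx
      rw [hR0 x hx, mul_zero]
    have hint := (hu.integrable_translate_prod hU h R).mul_bdd (g := fun z => φ z.2) (c := C)
      (hφ.continuous.comp continuous_snd).aestronglyMeasurable
      (Filter.Eventually.of_forall fun z => hCb _)
    have e := hu.integral_translate hφ hc h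
    rw [intervalIntegral.integral_of_le zero_le_one] at e
    simp only [smul_eq_mul, mul_comm (φ _)]
    rw [e, hres]
    simp only [hres]
    rw [integral_integral_swap hint]
    simp only [integral_mul_const]

/-- Jensen in `t`, Cauchy–Schwarz for `⟪U, h⟫`, then Tonelli. The translates of the ball stay in the
ball enlarged by `‖h‖`. -/
theorem HasWeakGradient.lintegral_translate_sub_le (hu : HasWeakGradient u U) (h : RN N) (R : ℝ) :
    ∫⁻ x in Metric.ball 0 R, ‖u (x + h) - u x‖ₑ ^ 2 ≤
      ‖h‖ₑ ^ 2 * ∫⁻ x in Metric.ball 0 (R + ‖h‖), ‖U x‖ₑ ^ 2 := by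
  -- A measurable representative makes `U (x + t • h)` jointly measurable in `(x, t)` and measurable
  -- in `t` for each fixed `x`.
  wlog hU : Measurable U generalizing U
  · have hm := hu.locIntGrad.aestronglyMeasurable
    have := this (hu.congr (ae_eq_refl u) hm.ae_eq_mk) hm.stronglyMeasurable_mk.measurable
    refine this.trans_eq ?_
    congr 1
    refine lintegral_congr_ae (ae_restrict_of_ae ?_)
    filter_upwards [hm.ae_eq_mk] with x hx
    rw [hx]
  have hm : Measurable fun z : RN N × ℝ => ‖U (z.1 + z.2 • h)‖ₑ ^ 2 :=
    (hU.comp (by fun_prop)).enorm.pow_const 2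
  calc ∫⁻ x in Metric.ball 0 R, ‖u (x + h) - u x‖ₑ ^ 2
      ≤ ∫⁻ x in Metric.ball 0 R, ∫⁻ t in Set.Ioc (0 : ℝ) 1,
          ‖h‖ₑ ^ 2 * ‖U (x + t • h)‖ₑ ^ 2 := by
        refine lintegral_mono_ae (ae_restrict_of_ae ?_)
        filter_upwards [hu.translate_ae hU h] with x hx
        rw [hx]
        have hp : IsProbabilityMeasure (volume.restrict (Set.Ioc (0 : ℝ) 1)) := ⟨by simp⟩
        have hmx : Measurable fun t : ℝ => U (x + t • h) := hU.comp (by fun_prop)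
        calc ‖∫ t in Set.Ioc (0 : ℝ) 1, ⟪U (x + t • h), h⟫‖ₑ ^ 2
            ≤ (∫⁻ t in Set.Ioc (0 : ℝ) 1, ‖⟪U (x + t • h), h⟫‖ₑ) ^ 2 := by
              gcongr; exact enorm_integral_le_lintegral_enorm _
          _ ≤ ∫⁻ t in Set.Ioc (0 : ℝ) 1, ‖⟪U (x + t • h), h⟫‖ₑ ^ 2 :=
              sq_lintegral_le (hmx.inner measurable_const).enorm.aemeasurable
          _ ≤ _ := lintegral_mono fun t => by
              rw [← mul_pow]
              gcongr
              rw [mul_comm, ← ofReal_norm, ← ofReal_norm,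
                ← ofReal_norm, ← ENNReal.ofReal_mul (norm_nonneg _)]
              exact ENNReal.ofReal_le_ofReal (norm_inner_le_norm _ _)
    _ = ∫⁻ t in Set.Ioc (0 : ℝ) 1, ‖h‖ₑ ^ 2 *
          ∫⁻ x in Metric.ball 0 R, ‖U (x + t • h)‖ₑ ^ 2 := by
        rw [lintegral_lintegral_swap (hm.const_mul _).aemeasurable]
        refine lintegral_congr fun t => ?_
        rw [lintegral_const_mul]
        exact (hU.comp (by fun_prop)).enorm.pow_const 2
    _ ≤ ∫⁻ _ in Set.Ioc (0 : ℝ) 1, ‖h‖ₑ ^ 2 *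
          ∫⁻ x in Metric.ball 0 (R + ‖h‖), ‖U x‖ₑ ^ 2 := by
        refine setLIntegral_mono' measurableSet_Ioc fun t ht => ?_
        refine mul_le_mul' le_rfl ?_
        exact lintegral_ball_translate_le (fun x => ‖U x‖ₑ ^ 2) R
          (abs_le.2 ⟨by linarith [ht.1], ht.2⟩)
    _ = _ := by simp

end Translation

/-! ### Local averages and Poincaré-type inequalities -/

section Poincare

variable {N : ℕ} {u : RN N → ℝ} {U : RN N → RN N}

theorem sq_lintegral_le_measure_mul {α : Type*} [MeasurableSpace α] {μ : Measure α}
    {f : α → ℝ≥0∞} (hf : AEMeasurable f μ) :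
    (∫⁻ x, f x ∂μ) ^ 2 ≤ μ Set.univ * ∫⁻ x, f x ^ 2 ∂μ := by
  have h := ENNReal.lintegral_mul_le_Lp_mul_Lq μ Real.HolderConjugate.two_two hf
    (g := fun _ => 1) aemeasurable_const
  simp only [Pi.mul_apply, mul_one, ENNReal.rpow_two, one_pow, lintegral_one] at h
  calc (∫⁻ x, f x ∂μ) ^ 2
      ≤ ((∫⁻ x, f x ^ 2 ∂μ) ^ (1 / 2 : ℝ) * μ Set.univ ^ (1 / 2 : ℝ)) ^ 2 := by gcongr
    _ = _ := by
      rw [mul_pow, ← ENNReal.rpow_natCast, ← ENNReal.rpow_mul, ← ENNReal.rpow_natCast,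
        ← ENNReal.rpow_mul]
      norm_num [mul_comm]

/-- Two points of a ball of radius `δ` differ by a vector of length less than `2 * δ`; substitute `y
= x + h`. -/
theorem lintegral_ball_le_translate (f : RN N → ℝ≥0∞) {p x : RN N} {δ : ℝ}
    (hx : x ∈ Metric.ball p δ) :
    ∫⁻ y in Metric.ball p δ, f y ≤ ∫⁻ h in Metric.ball 0 (2 * δ), f (x + h) := by
  rw [← lintegral_indicator Metric.isOpen_ball.measurableSet,
    ← lintegral_indicator Metric.isOpen_ball.measurableSet,
    ← lintegral_add_left_eq_self ((Metric.ball p δ).indicator f) x]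
  refine lintegral_mono fun h => ?_
  by_cases hh : x + h ∈ Metric.ball p δ
  · have h2 : h ∈ Metric.ball (0 : RN N) (2 * δ) := by
      rw [mem_ball_zero_iff]
      rw [Metric.mem_ball, dist_eq_norm] at hx hh
      calc ‖h‖ = ‖(x + h - p) - (x - p)‖ := by congr 1; abel
        _ ≤ ‖x + h - p‖ + ‖x - p‖ := norm_sub_le _ _
        _ < 2 * δ := by linarith
    rw [Set.indicator_of_mem hh, Set.indicator_of_mem h2]
  · rw [Set.indicator_of_notMem hh]; exact bot_le

theorem HasWeakGradient.lintegral_lintegral_translate_le (hu : HasWeakGradient u U) (R r : ℝ) :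
    ∫⁻ x in Metric.ball 0 R, ∫⁻ h in Metric.ball 0 r, ‖u (x + h) - u x‖ₑ ^ 2 ≤
      volume (Metric.ball (0 : RN N) r) *
        (ENNReal.ofReal r ^ 2 * ∫⁻ x in Metric.ball 0 (R + r), ‖U x‖ₑ ^ 2) := by
  have hm := hu.locInt.aestronglyMeasurable
  -- Since `u` is only a.e. strongly measurable, `u (x + h)` is measurable on the product because
  -- addition pulls null sets back to null sets.
  have hq : Measure.QuasiMeasurePreserving (fun z : RN N × RN N => z.1 + z.2)
      ((volume.restrict (Metric.ball 0 R)).prod (volume.restrict (Metric.ball 0 r))) volume := by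
    refine (quasiMeasurePreserving_add volume volume).mono_left ?_
    rw [Measure.prod_restrict]
    exact Measure.absolutelyContinuous_of_le Measure.restrict_le_self
  rw [lintegral_lintegral_swap]
  · calc _ ≤ ∫⁻ _ in Metric.ball (0 : RN N) r,
          (ENNReal.ofReal r ^ 2 * ∫⁻ x in Metric.ball 0 (R + r), ‖U x‖ₑ ^ 2) := by
          refine setLIntegral_mono' Metric.isOpen_ball.measurableSet fun h hh => ?_
          rw [mem_ball_zero_iff] at hh
          refine (hu.lintegral_translate_sub_le h R).trans (mul_le_mul' ?_ ?_)
          · rw [← ofReal_norm]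
            gcongr
          · exact lintegral_mono_set (Metric.ball_subset_ball (by linarith))
      _ = _ := by rw [setLIntegral_const, mul_comm]
  · have h1 := hm.comp_quasiMeasurePreserving hq
    have h2 : AEStronglyMeasurable (fun z : RN N × RN N => u z.1)
        ((volume.restrict (Metric.ball 0 R)).prod (volume.restrict (Metric.ball 0 r))) :=
      hm.restrict.comp_fst
    exact ((h1.sub h2).enorm).pow_const 2

/-- Jensen reduces the deviation to the increments `u(x + h) - u(x)` with `|h| < 2δ`. The constant
is `(2δ)²` times the volume ratio `2^N` of the balls of radii `2δ` and `δ`. A map `p` with finitely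
many values makes the averages a step function. -/
theorem HasWeakGradient.lintegral_sub_average_le (hu : HasWeakGradient u U) {Ω : Set (RN N)}
    (hΩm : MeasurableSet Ω) {R δ : ℝ} (hδ : 0 < δ) (hΩ : Ω ⊆ Metric.ball 0 R) {p : RN N → RN N}
    (hp : ∀ x ∈ Ω, x ∈ Metric.ball (p x) δ) :
    ∫⁻ x in Ω, ‖u x - ⨍ y in Metric.ball (p x) δ, u y‖ₑ ^ 2 ≤
      ENNReal.ofReal (2 ^ (N + 2) * δ ^ 2) *
        ∫⁻ x in Metric.ball 0 (R + 2 * δ), ‖U x‖ₑ ^ 2 := by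
  set B := volume (Metric.ball (0 : RN N) δ) with hB
  have hB0 : B ≠ 0 := (Metric.measure_ball_pos _ _ hδ).ne'
  have hBt : B ≠ ⊤ := measure_ball_lt_top.ne
  have hBp : ∀ q : RN N, volume (Metric.ball q δ) = B := fun q => by
    rw [hB, Measure.addHaar_ball_center]
  calc ∫⁻ x in Ω, ‖u x - ⨍ y in Metric.ball (p x) δ, u y‖ₑ ^ 2
      ≤ ∫⁻ x in Ω, B⁻¹ * ∫⁻ h in Metric.ball 0 (2 * δ), ‖u (x + h) - u x‖ₑ ^ 2 := by
        refine setLIntegral_mono' hΩm fun x hx => ?_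
        have hprob : IsProbabilityMeasure (B⁻¹ • volume.restrict (Metric.ball (p x) δ)) := by
          constructor
          rw [Measure.smul_apply, Measure.restrict_apply_univ, hBp, smul_eq_mul,
            ENNReal.inv_mul_cancel hB0 hBt]
        have hint : Integrable u (B⁻¹ • volume.restrict (Metric.ball (p x) δ)) :=
          Integrable.smul_measure (((hu.locInt.integrableOn_isCompact
            (isCompact_closedBall (p x) δ))).mono_set Metric.ball_subset_closedBall)
            (ENNReal.inv_ne_top.2 hB0)
        have h1 := enorm_sub_integral_sq_le hint (u x)
        rw [lintegral_smul_measure, smul_eq_mul] at h1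
        have h2 : ⨍ y in Metric.ball (p x) δ, u y =
            ∫ y, u y ∂(B⁻¹ • volume.restrict (Metric.ball (p x) δ)) := by
          rw [average, Measure.restrict_apply_univ, hBp]
        rw [h2]
        refine h1.trans (mul_le_mul' le_rfl ?_)
        refine (lintegral_ball_le_translate (fun y => ‖u x - u y‖ₑ ^ 2) (hp x hx)).trans_eq ?_
        simp only [enorm_sub_rev]
    _ ≤ ∫⁻ x in Metric.ball 0 R, B⁻¹ *
          ∫⁻ h in Metric.ball 0 (2 * δ), ‖u (x + h) - u x‖ₑ ^ 2 := lintegral_mono_set hΩ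
    _ ≤ B⁻¹ * (volume (Metric.ball (0 : RN N) (2 * δ)) * (ENNReal.ofReal (2 * δ) ^ 2 *
          ∫⁻ x in Metric.ball 0 (R + 2 * δ), ‖U x‖ₑ ^ 2)) := by
        rw [lintegral_const_mul' _ _ (ENNReal.inv_ne_top.2 hB0)]
        exact mul_le_mul' le_rfl (hu.lintegral_lintegral_translate_le R (2 * δ))
    _ = _ := by
        have h1 : volume (Metric.ball (0 : RN N) (2 * δ)) = ENNReal.ofReal (2 ^ N) * B := by
          rw [Measure.addHaar_ball_mul_of_pos volume _ (by norm_num : (0 : ℝ) < 2)]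
          simp [hB]
        rw [h1, ← mul_assoc, ← mul_assoc, mul_comm B⁻¹, mul_assoc _ B, ENNReal.mul_inv_cancel hB0 hBt,
          mul_one, ← ENNReal.ofReal_pow (by positivity), ← ENNReal.ofReal_mul (by positivity)]
        congr 2
        ring

/-- A smooth weight in `Ω` of integral one, with the Jensen inequality for the weighted averages. -/
theorem exists_smooth_average {Ω : Set (RN N)} (hΩ : IsOpen Ω) (hne : Ω.Nonempty) :
    ∃ φ : RN N → ℝ, ContDiff ℝ ∞ φ ∧ HasCompactSupport φ ∧ tsupport φ ⊆ Ω ∧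
      ∃ C : ℝ≥0∞, C ≠ ⊤ ∧ ∀ {G : Type} [NormedAddCommGroup G] [NormedSpace ℝ G] [CompleteSpace G]
        (F : RN N → G), LocallyIntegrable F volume → ∀ a : G,
        ‖a - ∫ y, φ y • F y‖ₑ ^ 2 ≤ C * ∫⁻ y in Ω, ‖a - F y‖ₑ ^ 2 := by
  obtain ⟨x₀, hx₀⟩ := hne
  obtain ⟨ε, hε, hball⟩ := Metric.isOpen_iff.1 hΩ x₀ hx₀
  set f : ContDiffBump x₀ := ⟨ε / 4, ε / 2, by positivity, by linarith⟩ with hf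
  set φ := f.normed volume with hφ
  have hs : tsupport φ ⊆ Ω := by
    rw [hφ, f.tsupport_normed_eq]
    refine (Metric.closedBall_subset_ball ?_).trans hball
    change ε / 2 < ε
    linarith
  have hcont : Continuous φ := (f.contDiff_normed (n := 0)).continuous
  obtain ⟨C, hC, hCb⟩ := HasCompactSupport.exists_bound hcont f.hasCompactSupport_normed
  refine ⟨φ, f.contDiff_normed, f.hasCompactSupport_normed, hs, ENNReal.ofReal C,
    ENNReal.ofReal_ne_top, fun {G} _ _ _ F hF a => ?_⟩
  -- Jensen is applied to the probability measure `φ dx`; the density is then bounded by `C` on `Ω`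
  -- and vanishes off it. Smoothness of `φ` serves later, to integrate averages of a gradient by
  -- parts.
  set P := volume.withDensity fun x => ENNReal.ofReal (φ x) with hP
  have hφm : Measurable fun x => ENNReal.ofReal (φ x) := hcont.measurable.ennreal_ofReal
  have hprob : IsProbabilityMeasure P := by
    constructor
    rw [hP, withDensity_apply _ MeasurableSet.univ, Measure.restrict_univ,
      ← ofReal_integral_eq_lintegral_ofReal (hcont.integrable_of_hasCompactSupport
        f.hasCompactSupport_normed) (Filter.Eventually.of_forall fun x => f.nonneg_normed x),
      f.integral_normed, ENNReal.ofReal_one]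
  have htoReal : ∀ x, (ENNReal.ofReal (φ x)).toReal = φ x := fun x =>
    ENNReal.toReal_ofReal (f.nonneg_normed x)
  have hint : Integrable F P := by
    rw [hP, integrable_withDensity_iff_integrable_smul' hφm (by simp)]
    simp only [htoReal]
    exact hF.integrable_smul_left_of_hasCompactSupport hcont f.hasCompactSupport_normed
  have he : ∫ y, F y ∂P = ∫ y, φ y • F y := by
    rw [hP, integral_withDensity_eq_integral_toReal_smul hφm (by simp)]
    simp only [htoReal]
  rw [← he]
  refine (enorm_sub_integral_sq_le hint a).trans ?_
  rw [hP, lintegral_withDensity_eq_lintegral_mul₀ hφm.aemeasurable]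
  · rw [← lintegral_const_mul' _ _ ENNReal.ofReal_ne_top, ← lintegral_indicator hΩ.measurableSet]
    refine lintegral_mono fun x => ?_
    by_cases hx : x ∈ Ω
    · rw [Set.indicator_of_mem hx, Pi.mul_apply]
      exact mul_le_mul' (ENNReal.ofReal_le_ofReal ((le_abs_self _).trans (hCb x))) le_rfl
    · rw [Pi.mul_apply, image_eq_zero_of_notMem_tsupport fun h => hx (hs h)]
      simp
  · exact (aestronglyMeasurable_const.sub hF.aestronglyMeasurable).enorm.pow_const 2

end Poincare

/-! ### The energy of a vector field and what it controls -/

section Energy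

variable {N : ℕ} {σ : ℝ} {Ω : Set (RN N)} {u v : RN N → ℝ} {U V : RN N → RN N}

/-- The weighted difference `(U x - U y) / |x - y|^{(N+2σ)/2}`. -/
noncomputable def gagliardoDiff (σ : ℝ) (U : RN N → RN N) (z : RN N × RN N) : RN N :=
  ‖z.1 - z.2‖ ^ (-(((N : ℝ) + 2 * σ) / 2)) • (U z.1 - U z.2)

/-- Valid also for `d = 0` with the conventional values of powers and inverses, so the diagonal
needs no separate treatment. -/
theorem rpow_neg_half_sq {d : ℝ} (hd : 0 ≤ d) (p : ℝ) : (d ^ (-(p / 2))) ^ 2 = (d ^ p)⁻¹ := by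
  rw [← Real.rpow_natCast, ← Real.rpow_mul hd, ← Real.rpow_neg hd]
  congr 1
  push_cast
  ring

theorem inner_gagliardoDiff (U V : RN N → RN N) (z : RN N × RN N) :
    ⟪gagliardoDiff σ U z, gagliardoDiff σ V z⟫ =
      ⟪U z.1 - U z.2, V z.1 - V z.2⟫ / ‖z.1 - z.2‖ ^ ((N : ℝ) + 2 * σ) := by
  rw [gagliardoDiff, gagliardoDiff, real_inner_smul_left, real_inner_smul_right, ← mul_assoc,
    ← sq, rpow_neg_half_sq (norm_nonneg _), div_eq_inv_mul]

theorem enorm_sq_eq_ofReal {G : Type*} [NormedAddCommGroup G] (a : G) :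
    ‖a‖ₑ ^ 2 = ENNReal.ofReal (‖a‖ ^ 2) := by
  rw [ENNReal.ofReal_pow (norm_nonneg _), ofReal_norm]

theorem enorm_gagliardoDiff_sq (U : RN N → RN N) (z : RN N × RN N) :
    ‖gagliardoDiff σ U z‖ₑ ^ 2 =
      ENNReal.ofReal (‖U z.1 - U z.2‖ ^ 2 / ‖z.1 - z.2‖ ^ ((N : ℝ) + 2 * σ)) := by
  rw [enorm_sq_eq_ofReal, ← real_inner_self_eq_norm_sq, inner_gagliardoDiff,
    real_inner_self_eq_norm_sq]

theorem gagliardoDiff_add (U V : RN N → RN N) :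
    gagliardoDiff σ (U + V) = gagliardoDiff σ U + gagliardoDiff σ V := by
  ext1 z
  simp only [gagliardoDiff, Pi.add_apply, ← smul_add]
  congr 1
  abel

theorem gagliardoDiff_smul (c : ℝ) (U : RN N → RN N) :
    gagliardoDiff σ (c • U) = c • gagliardoDiff σ U := by
  ext1 z
  simp only [gagliardoDiff, Pi.smul_apply, ← smul_sub, smul_comm c]

/-- A null set of `x`, or of `y`, is null in the product, so the energy depends only on the a.e.
class of the field. -/
theorem gagliardoDiff_congr (h : U =ᵐ[volume] V) :
    gagliardoDiff σ U =ᵐ[(volume : Measure (RN N)).prod volume] gagliardoDiff σ V := by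
  have h1 := Measure.quasiMeasurePreserving_fst (μ := (volume : Measure (RN N)))
    (ν := (volume : Measure (RN N))) |>.ae_eq_comp h
  have h2 := Measure.quasiMeasurePreserving_snd (μ := (volume : Measure (RN N)))
    (ν := (volume : Measure (RN N))) |>.ae_eq_comp h
  filter_upwards [h1, h2] with z hz1 hz2
  simp only [Function.comp_apply] at hz1 hz2
  rw [gagliardoDiff, gagliardoDiff, hz1, hz2]

theorem measurable_kernel (p : ℝ) : Measurable fun z : RN N × RN N => ‖z.1 - z.2‖ ^ p :=
  (measurable_fst.sub measurable_snd).norm.pow_const p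

theorem aestronglyMeasurable_gagliardoDiff (hU : AEStronglyMeasurable U volume) :
    AEStronglyMeasurable (gagliardoDiff σ U) ((volume : Measure (RN N)).prod volume) :=
  (measurable_kernel _).aestronglyMeasurable.smul (hU.comp_fst.sub hU.comp_snd)

/-- The measure `dx dy` on `Q(Ω)`. -/
noncomputable def qMeasure (Ω : Set (RN N)) : Measure (RN N × RN N) :=
  ((volume : Measure (RN N)).prod volume).restrict (Qset Ω)

/-- The energy of a vector field. -/
noncomputable def fieldEnergy (σ : ℝ) (Ω : Set (RN N)) (U : RN N → RN N) : ℝ≥0∞ :=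
  ∫⁻ z, ‖gagliardoDiff σ U z‖ₑ ^ 2 ∂(qMeasure Ω)

theorem energy_eq (h : HasWeakGradient u U) : energy σ Ω u = fieldEnergy σ Ω U := by
  rw [energy, fieldEnergy, qMeasure]
  refine lintegral_congr_ae (ae_restrict_of_ae ?_)
  filter_upwards [gagliardoDiff_congr (σ := σ) h.weakGradient_ae] with z hz
  rw [← hz, enorm_gagliardoDiff_sq]

theorem energyForm_eq (hu : HasWeakGradient u U) (hv : HasWeakGradient v V) :
    energyForm σ Ω u v = ∫ z, ⟪gagliardoDiff σ U z, gagliardoDiff σ V z⟫ ∂(qMeasure Ω) := by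
  rw [energyForm, qMeasure]
  refine integral_congr_ae (ae_restrict_of_ae ?_)
  filter_upwards [gagliardoDiff_congr (σ := σ) hu.weakGradient_ae,
    gagliardoDiff_congr (σ := σ) hv.weakGradient_ae] with z hz hz'
  rw [← hz, ← hz', inner_gagliardoDiff]

/-- One point in `Ω` is enough to lie in `Q(Ω)`, however far away the other is. This is why the
energy sees the gradient outside `Ω`. -/
theorem ball_prod_subset_Qset (A : Set (RN N)) : A ×ˢ Ω ⊆ Qset Ω := fun _ hz hz' =>
  hz'.2 hz.2

/-- Inside a ball `|x - y| ≤ 2R`, so the weight is bounded below; its singularity only helps. -/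
theorem enorm_sub_sq_le_gagliardoDiff (hσ : 0 < σ) {R : ℝ} {z : RN N × RN N}
    (h1 : z.1 ∈ Metric.ball 0 R) (h2 : z.2 ∈ Metric.ball 0 R) :
    ‖U z.1 - U z.2‖ₑ ^ 2 ≤ ENNReal.ofReal ((2 * R) ^ ((N : ℝ) + 2 * σ)) *
      ‖gagliardoDiff σ U z‖ₑ ^ 2 := by
  by_cases hz : z.1 = z.2
  · simp [hz]
  have hd : 0 < ‖z.1 - z.2‖ := norm_pos_iff.2 (sub_ne_zero.2 hz)
  have hle : ‖z.1 - z.2‖ ≤ 2 * R := by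
    rw [mem_ball_zero_iff] at h1 h2
    linarith [norm_sub_le z.1 z.2]
  have hp : 0 < ‖z.1 - z.2‖ ^ ((N : ℝ) + 2 * σ) := Real.rpow_pos_of_pos hd _
  rw [enorm_gagliardoDiff_sq, enorm_sq_eq_ofReal,
    ← ENNReal.ofReal_mul (Real.rpow_nonneg (hd.le.trans hle) _)]
  refine ENNReal.ofReal_le_ofReal ?_
  have h3 : ‖z.1 - z.2‖ ^ ((N : ℝ) + 2 * σ) ≤ (2 * R) ^ ((N : ℝ) + 2 * σ) :=
    Real.rpow_le_rpow hd.le hle (by positivity)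
  rw [mul_div_assoc', le_div_iff₀ hp, mul_comm]
  exact mul_le_mul_of_nonneg_right h3 (sq_nonneg _)

theorem lintegral_lintegral_sub_le_fieldEnergy (hσ : 0 < σ) {R : ℝ}
    (hΩ : Ω ⊆ Metric.ball 0 R) (hU : AEStronglyMeasurable U volume) :
    ∫⁻ x in Metric.ball 0 R, ∫⁻ y in Ω, ‖U x - U y‖ₑ ^ 2 ≤
      ENNReal.ofReal ((2 * R) ^ ((N : ℝ) + 2 * σ)) * fieldEnergy σ Ω U := by
  have hm : AEMeasurable (fun z : RN N × RN N => ‖U z.1 - U z.2‖ₑ ^ 2)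
      ((volume.restrict (Metric.ball 0 R)).prod (volume.restrict Ω)) :=
    ((hU.restrict.comp_fst.sub hU.restrict.comp_snd).enorm).pow_const 2
  rw [lintegral_lintegral hm, Measure.prod_restrict, fieldEnergy, qMeasure,
    ← lintegral_const_mul' _ _ ENNReal.ofReal_ne_top]
  refine le_trans (lintegral_mono_ae ?_) (lintegral_mono_set (ball_prod_subset_Qset _))
  refine Filter.Eventually.filter_mono (ae_mono (Measure.restrict_mono (Set.prod_mono_right hΩ :
    Metric.ball (0 : RN N) R ×ˢ Ω ⊆ Metric.ball 0 R ×ˢ (Metric.ball 0 R)) le_rfl)) ?_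
  filter_upwards [ae_restrict_mem (Metric.isOpen_ball.measurableSet.prod
    Metric.isOpen_ball.measurableSet)] with z hz
  exact enorm_sub_sq_le_gagliardoDiff hσ hz.1 hz.2

/-- By parts, the average of the gradient is `-∫ u ∇φ`, and `∇φ` is bounded and supported in `Ω`. -/
theorem HasWeakGradient.enorm_average_sq_le (hΩ : IsOpen Ω) {R : ℝ} (hR : Ω ⊆ Metric.ball 0 R)
    {φ : RN N → ℝ}
    (hφ : ContDiff ℝ ∞ φ) (hc : HasCompactSupport φ) (hs : tsupport φ ⊆ Ω) :
    ∃ C : ℝ≥0∞, C ≠ ⊤ ∧ ∀ {u : RN N → ℝ} {U : RN N → RN N}, HasWeakGradient u U →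
      ‖∫ y, φ y • U y‖ₑ ^ 2 ≤ C * ∫⁻ y in Ω, ‖u y‖ₑ ^ 2 := by
  have hfc : Continuous (fderiv ℝ φ) := hφ.continuous_fderiv (by simp)
  obtain ⟨B, hB⟩ := (hc.fderiv ℝ).exists_bound_of_continuous hfc
  have hB0 : 0 ≤ B := (norm_nonneg _).trans (hB 0)
  refine ⟨ENNReal.ofReal B ^ 2 * volume Ω, ?_, fun {u U} hu => ?_⟩
  · exact ENNReal.mul_ne_top (by simp)
      ((measure_mono hR).trans_lt measure_ball_lt_top).ne
  set m := ∫ y, φ y • U y with hm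
  have hint : Integrable (fun y => φ y • U y) volume :=
    hu.locIntGrad.integrable_smul_left_of_hasCompactSupport hφ.continuous hc
  -- Testing in the direction `m` itself reduces the vector identity to a scalar one; a factor `‖m‖`
  -- is cancelled afterwards.
  have h1 : ‖m‖ ^ 2 = - ∫ x, u x * fderiv ℝ φ x m := by
    rw [← hu.parts_inner hφ hc m, ← real_inner_self_eq_norm_sq]
    conv_lhs => rw [real_inner_comm]; arg 3; rw [hm]
    rw [← integral_inner hint]
    exact integral_congr_ae (Filter.Eventually.of_forall fun x => by
      simp only [real_inner_smul_right, real_inner_comm m, mul_comm])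
  have h2 : ‖m‖ₑ ^ 2 ≤ ‖m‖ₑ * (ENNReal.ofReal B * ∫⁻ y in Ω, ‖u y‖ₑ) := by
    calc ‖m‖ₑ ^ 2 = ‖∫ x, u x * fderiv ℝ φ x m‖ₑ := by
          rw [enorm_sq_eq_ofReal, h1, ← ofReal_norm, Real.norm_eq_abs, abs_of_nonpos (by nlinarith [sq_nonneg ‖m‖])]
      _ ≤ ∫⁻ x, ‖u x * fderiv ℝ φ x m‖ₑ := enorm_integral_le_lintegral_enorm _
      _ ≤ ∫⁻ x in Ω, (‖m‖ₑ * ENNReal.ofReal B) * ‖u x‖ₑ := by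
          rw [← lintegral_indicator hΩ.measurableSet]
          refine lintegral_mono fun x => ?_
          by_cases hx : x ∈ Ω
          · rw [Set.indicator_of_mem hx, enorm_mul, mul_comm]
            gcongr
            rw [← ofReal_norm, ← ofReal_norm, ← ENNReal.ofReal_mul (norm_nonneg _)]
            refine ENNReal.ofReal_le_ofReal (((fderiv ℝ φ x).le_opNorm m).trans ?_)
            rw [mul_comm]
            exact mul_le_mul_of_nonneg_left (hB x) (norm_nonneg _)
          · have : fderiv ℝ φ x = 0 := image_eq_zero_of_notMem_tsupport fun h =>
              hx (hs (tsupport_fderiv_subset ℝ h))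
            simp [this]
      _ = _ := by
          rw [lintegral_const_mul' _ _ (by finiteness), mul_assoc]
  have h3 : ‖m‖ₑ ≤ ENNReal.ofReal B * ∫⁻ y in Ω, ‖u y‖ₑ := by
    by_cases h0 : ‖m‖ₑ = 0
    · rw [h0]; exact bot_le
    · rw [sq] at h2
      exact (ENNReal.mul_le_mul_iff_right h0 enorm_ne_top).1 h2
  calc ‖m‖ₑ ^ 2 ≤ (ENNReal.ofReal B * ∫⁻ y in Ω, ‖u y‖ₑ) ^ 2 := by gcongr
    _ = ENNReal.ofReal B ^ 2 * (∫⁻ y in Ω, ‖u y‖ₑ) ^ 2 := mul_pow _ _ _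
    _ ≤ ENNReal.ofReal B ^ 2 * (volume Ω * ∫⁻ y in Ω, ‖u y‖ₑ ^ 2) := by
        gcongr
        have := sq_lintegral_le_measure_mul (μ := volume.restrict Ω)
          hu.locInt.aestronglyMeasurable.restrict.enorm
        rwa [Measure.restrict_apply_univ] at this
    _ = _ := (mul_assoc _ _ _).symm

/-- The gradient on a ball is controlled by the norm of the energy space. -/
theorem exists_lintegral_gradient_le (hσ : 0 < σ) (hΩ : IsOpen Ω) (hne : Ω.Nonempty) {R : ℝ}
    (hR : Ω ⊆ Metric.ball 0 R) :
    ∃ C : ℝ≥0∞, C ≠ ⊤ ∧ ∀ {u : RN N → ℝ} {U : RN N → RN N}, HasWeakGradient u U →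
      ∫⁻ x in Metric.ball 0 R, ‖U x‖ₑ ^ 2 ≤
        C * ((∫⁻ x in Ω, ‖u x‖ₑ ^ 2) + fieldEnergy σ Ω U) := by
  obtain ⟨φ, hφ, hc, hs, C₁, hC₁, hJ⟩ := exists_smooth_average hΩ hne
  obtain ⟨C₂, hC₂, hm⟩ := HasWeakGradient.enorm_average_sq_le hΩ hR hφ hc hs
  set K := ENNReal.ofReal ((2 * R) ^ ((N : ℝ) + 2 * σ)) with hK
  set B := volume (Metric.ball (0 : RN N) R) with hB
  have hBt : B ≠ ⊤ := measure_ball_lt_top.ne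
  refine ⟨2 * (C₁ * K) + 2 * C₂ * B, by finiteness, fun {u U} hu => ?_⟩
  set m := ∫ y, φ y • U y with hmdef
  have hU := hu.locIntGrad.aestronglyMeasurable
  -- Split `U x = (U x - m) + m`: the first term is bounded by the energy through Jensen, the second
  -- by `u` on `Ω` through integration by parts.
  calc ∫⁻ x in Metric.ball 0 R, ‖U x‖ₑ ^ 2
      ≤ ∫⁻ x in Metric.ball 0 R, (2 * (C₁ * ∫⁻ y in Ω, ‖U x - U y‖ₑ ^ 2) + 2 * ‖m‖ₑ ^ 2) := by
        refine lintegral_mono fun x => (enorm_sq_le_two_mul (U x) m).trans ?_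
        gcongr
        exact hJ U hu.locIntGrad (U x)
    _ = 2 * (C₁ * ∫⁻ x in Metric.ball 0 R, ∫⁻ y in Ω, ‖U x - U y‖ₑ ^ 2) +
          2 * ‖m‖ₑ ^ 2 * B := by
        rw [lintegral_add_right' _ aemeasurable_const, setLIntegral_const,
          lintegral_const_mul' _ _ (by simp), lintegral_const_mul' _ _ hC₁]
    _ ≤ 2 * (C₁ * (K * fieldEnergy σ Ω U)) + 2 * (C₂ * ∫⁻ y in Ω, ‖u y‖ₑ ^ 2) * B := by
        gcongr
        · exact lintegral_lintegral_sub_le_fieldEnergy hσ hR hU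
        · exact hm hu
    _ = 2 * (C₁ * K) * fieldEnergy σ Ω U + 2 * C₂ * B * ∫⁻ y in Ω, ‖u y‖ₑ ^ 2 := by ring
    _ ≤ 2 * (C₁ * K) * ((∫⁻ x in Ω, ‖u x‖ₑ ^ 2) + fieldEnergy σ Ω U) +
          2 * C₂ * B * ((∫⁻ x in Ω, ‖u x‖ₑ ^ 2) + fieldEnergy σ Ω U) := by
        gcongr
        · exact le_add_self
        · exact le_self_add
    _ = _ := by ring

theorem HasWeakGradient.lintegral_lintegral_sub_le (hu : HasWeakGradient u U) {R : ℝ}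
    (hR : Ω ⊆ Metric.ball 0 R) :
    ∫⁻ x in Metric.ball 0 R, ∫⁻ y in Ω, ‖u x - u y‖ₑ ^ 2 ≤
      volume (Metric.ball (0 : RN N) (2 * R)) *
        (ENNReal.ofReal (2 * R) ^ 2 * ∫⁻ x in Metric.ball 0 (R + 2 * R), ‖U x‖ₑ ^ 2) := by
  refine le_trans (setLIntegral_mono' Metric.isOpen_ball.measurableSet fun x hx => ?_)
    (hu.lintegral_lintegral_translate_le R (2 * R))
  refine (lintegral_mono_set hR).trans ((lintegral_ball_le_translate
    (fun y => ‖u x - u y‖ₑ ^ 2) hx).trans_eq ?_)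
  simp only [enorm_sub_rev]

/-- The function on a ball is controlled by the norm of the energy space. -/
theorem exists_lintegral_le (hσ : 0 < σ) (hΩ : IsOpen Ω) (hne : Ω.Nonempty) {R : ℝ}
    (hR : Ω ⊆ Metric.ball 0 R) :
    ∃ C : ℝ≥0∞, C ≠ ⊤ ∧ ∀ {u : RN N → ℝ} {U : RN N → RN N}, HasWeakGradient u U →
      ∫⁻ x in Metric.ball 0 R, ‖u x‖ₑ ^ 2 ≤
        C * ((∫⁻ x in Ω, ‖u x‖ₑ ^ 2) + fieldEnergy σ Ω U) := by
  obtain ⟨φ, hφ, hc, hs, C₁, hC₁, hJ⟩ := exists_smooth_average hΩ hne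
  have hR0 : 0 < R := by
    obtain ⟨x, hx⟩ := hne
    exact (norm_nonneg x).trans_lt (mem_ball_zero_iff.1 (hR hx))
  -- Increments between points of the ball have length up to `2 * R`, so the translation estimate
  -- needs the gradient on radius `R + 2 * R`.
  obtain ⟨C₃, hC₃, hG⟩ := exists_lintegral_gradient_le hσ hΩ hne
    (hR.trans (Metric.ball_subset_ball (by linarith : R ≤ R + 2 * R)))
  set B := volume (Metric.ball (0 : RN N) R) with hB
  have hBt : B ≠ ⊤ := measure_ball_lt_top.ne
  set D := volume (Metric.ball (0 : RN N) (2 * R)) with hD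
  have hDt : D ≠ ⊤ := measure_ball_lt_top.ne
  set K := ENNReal.ofReal (2 * R) ^ 2 with hK
  have hKt : K ≠ ⊤ := by finiteness
  refine ⟨2 * (C₁ * (D * (K * C₃))) + 2 * C₁ * B, by finiteness, fun {u U} hu => ?_⟩
  set m := ∫ y, φ y • u y with hmdef
  have hm : ‖m‖ₑ ^ 2 ≤ C₁ * ∫⁻ y in Ω, ‖u y‖ₑ ^ 2 := by
    simpa only [zero_sub, enorm_neg] using hJ u hu.locInt 0
  calc ∫⁻ x in Metric.ball 0 R, ‖u x‖ₑ ^ 2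
      ≤ ∫⁻ x in Metric.ball 0 R, (2 * (C₁ * ∫⁻ y in Ω, ‖u x - u y‖ₑ ^ 2) + 2 * ‖m‖ₑ ^ 2) := by
        refine lintegral_mono fun x => (enorm_sq_le_two_mul (u x) m).trans ?_
        gcongr
        exact hJ u hu.locInt (u x)
    _ = 2 * (C₁ * ∫⁻ x in Metric.ball 0 R, ∫⁻ y in Ω, ‖u x - u y‖ₑ ^ 2) +
          2 * ‖m‖ₑ ^ 2 * B := by
        rw [lintegral_add_right' _ aemeasurable_const, setLIntegral_const,
          lintegral_const_mul' _ _ (by simp), lintegral_const_mul' _ _ hC₁]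
    _ ≤ 2 * (C₁ * (D * (K * (C₃ * ((∫⁻ x in Ω, ‖u x‖ₑ ^ 2) + fieldEnergy σ Ω U))))) +
          2 * (C₁ * ∫⁻ y in Ω, ‖u y‖ₑ ^ 2) * B := by
        gcongr
        exact (hu.lintegral_lintegral_sub_le hR).trans
          (mul_le_mul' le_rfl (mul_le_mul' le_rfl (hG hu)))
    _ ≤ 2 * (C₁ * (D * (K * (C₃ * ((∫⁻ x in Ω, ‖u x‖ₑ ^ 2) + fieldEnergy σ Ω U))))) +
          2 * (C₁ * ((∫⁻ x in Ω, ‖u x‖ₑ ^ 2) + fieldEnergy σ Ω U)) * B := by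
        gcongr
        exact le_self_add
    _ = _ := by ring

theorem ae_eq_of_forall_ball {G : Type*} {f g : RN N → G} {R₀ : ℝ}
    (h : ∀ R : ℝ, R₀ ≤ R → f =ᵐ[volume.restrict (Metric.ball 0 R)] g) : f =ᵐ[volume] g := by
  have h1 : ∀ n : ℕ, ∀ᵐ x : RN N, x ∈ Metric.ball (0 : RN N) (max R₀ n) → f x = g x := fun n =>
    (ae_restrict_iff' Metric.isOpen_ball.measurableSet).1 (h _ (le_max_left _ _))
  filter_upwards [ae_all_iff.2 h1] with x hx
  obtain ⟨n, hn⟩ := exists_nat_gt ‖x‖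
  exact hx n (mem_ball_zero_iff.2 (hn.trans_le (le_max_right _ _)))

theorem ae_eq_const_of_lintegral_zero {G : Type} [NormedAddCommGroup G] {F : RN N → G} {m : G}
    (hF : AEStronglyMeasurable F volume) {R₀ : ℝ}
    (h : ∀ R : ℝ, R₀ ≤ R → ∫⁻ x in Metric.ball 0 R, ‖F x - m‖ₑ ^ 2 = 0) :
    F =ᵐ[volume] fun _ => m := by
  refine ae_eq_of_forall_ball (R₀ := R₀) fun R hR => ?_
  have h1 := h R hR
  have hm : AEMeasurable (fun x => ‖F x - m‖ₑ ^ 2) (volume.restrict (Metric.ball 0 R)) :=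
    ((hF.sub aestronglyMeasurable_const).restrict.enorm).pow_const 2
  filter_upwards [(lintegral_eq_zero_iff' hm).1 h1] with x hx
  simpa [sub_eq_zero] using hx

theorem hasWeakGradient_affine (c₀ : ℝ) (c : RN N) :
    HasWeakGradient (fun x => c₀ + ⟪c, x⟫) fun _ => c := by
  have h := hasWeakGradient_of_contDiff (N := N) (u := fun x => c₀ + ⟪c, x⟫)
    (contDiff_const.add (contDiff_const.inner ℝ contDiff_id))
  refine h.congr (ae_eq_refl _) (Filter.Eventually.of_forall fun x => ?_)
  have hg : HasGradientAt (fun x : RN N => c₀ + ⟪c, x⟫) c x := by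
    rw [hasGradientAt_iff_hasFDerivAt]
    exact ((InnerProductSpace.toDual ℝ (RN N) c).hasFDerivAt).const_add c₀
  exact hg.gradient

/-- Functions without energy are affine. -/
theorem HasWeakGradient.exists_affine (hu : HasWeakGradient u U) (hσ : 0 < σ) (hΩ : IsOpen Ω)
    (hne : Ω.Nonempty) (hb : Bornology.IsBounded Ω) (h0 : fieldEnergy σ Ω U = 0) :
    ∃ q, IsAffineFunction q ∧ u =ᵐ[volume] q := by
  obtain ⟨φ, hφ, hc, hs, C₁, hC₁, hJ⟩ := exists_smooth_average hΩ hne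
  obtain ⟨R₀, hR₀⟩ := hb.subset_ball (0 : RN N)
  have hU := hu.locIntGrad.aestronglyMeasurable
  set m := ∫ y, φ y • U y with hm
  -- Without energy, `U` agrees on every large ball with its average over `Ω`, hence is constant on
  -- the whole space.
  have h1 : U =ᵐ[volume] fun _ => m := by
    refine ae_eq_const_of_lintegral_zero hU (R₀ := R₀) fun R hR => le_antisymm ?_ bot_le
    calc ∫⁻ x in Metric.ball 0 R, ‖U x - m‖ₑ ^ 2
        ≤ ∫⁻ x in Metric.ball 0 R, C₁ * ∫⁻ y in Ω, ‖U x - U y‖ₑ ^ 2 :=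
          lintegral_mono fun x => hJ U hu.locIntGrad (U x)
      _ = C₁ * ∫⁻ x in Metric.ball 0 R, ∫⁻ y in Ω, ‖U x - U y‖ₑ ^ 2 :=
          lintegral_const_mul' _ _ hC₁
      _ ≤ C₁ * (ENNReal.ofReal ((2 * R) ^ ((N : ℝ) + 2 * σ)) * fieldEnergy σ Ω U) :=
          mul_le_mul' le_rfl (lintegral_lintegral_sub_le_fieldEnergy hσ
            (hR₀.trans (Metric.ball_subset_ball hR)) hU)
      _ = 0 := by rw [h0]; simp
  have hw : HasWeakGradient (u - fun x => 0 + ⟪m, x⟫) 0 := by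
    refine (hu.sub (hasWeakGradient_affine 0 m)).congr (ae_eq_refl _) ?_
    filter_upwards [h1] with x hx
    simp [hx]
  set w := u - fun x => 0 + ⟪m, x⟫ with hwdef
  -- After the linear part is subtracted the gradient is zero; the same averaging argument, now with
  -- the translation estimate, makes `w` constant.
  have h2 : w =ᵐ[volume] fun _ => ∫ y, φ y • w y := by
    refine ae_eq_const_of_lintegral_zero hw.locInt.aestronglyMeasurable (R₀ := R₀) fun R hR =>
      le_antisymm ?_ bot_le
    calc ∫⁻ x in Metric.ball 0 R, ‖w x - ∫ y, φ y • w y‖ₑ ^ 2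
        ≤ ∫⁻ x in Metric.ball 0 R, C₁ * ∫⁻ y in Ω, ‖w x - w y‖ₑ ^ 2 :=
          lintegral_mono fun x => hJ w hw.locInt (w x)
      _ = C₁ * ∫⁻ x in Metric.ball 0 R, ∫⁻ y in Ω, ‖w x - w y‖ₑ ^ 2 :=
          lintegral_const_mul' _ _ hC₁
      _ ≤ C₁ * _ := mul_le_mul' le_rfl (hw.lintegral_lintegral_sub_le
            (hR₀.trans (Metric.ball_subset_ball hR)))
      _ = 0 := by simp
  refine ⟨fun x => (∫ y, φ y • w y) + ⟪m, x⟫, ⟨_, m, fun _ => rfl⟩, ?_⟩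
  filter_upwards [h2] with x hx
  rw [← hx, hwdef]
  simp

end Energy

/-! ### Local `L²` limits -/

section LimitOnBalls

variable {N : ℕ} {G : Type*} [NormedAddCommGroup G]

theorem ae_eq_of_tendsto_eLpNorm {α : Type*} [MeasurableSpace α] {μ : Measure α}
    {F : ℕ → α → G} {f g : α → G} (hF : ∀ n, AEStronglyMeasurable (F n) μ)
    (hf : AEStronglyMeasurable f μ) (hg : AEStronglyMeasurable g μ)
    (h1 : Tendsto (fun n => eLpNorm (F n - f) 2 μ) atTop (𝓝 0))
    (h2 : Tendsto (fun n => eLpNorm (F n - g) 2 μ) atTop (𝓝 0)) : f =ᵐ[μ] g :=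
  tendstoInMeasure_ae_unique (tendstoInMeasure_of_tendsto_eLpNorm two_ne_zero hF hf h1)
    (tendstoInMeasure_of_tendsto_eLpNorm two_ne_zero hF hg h2)

/-- A sequence that is Cauchy in `L²` of each ball has a common limit. -/
theorem exists_limit_on_balls [CompleteSpace G] {F : ℕ → RN N → G} {r : ℕ → ℝ}
    (hr : ∀ x : RN N, ∃ k, x ∈ Metric.ball 0 (r k))
    (hF : ∀ k n, MemLp (F n) 2 (volume.restrict (Metric.ball 0 (r k))))
    (hC : ∀ k, ∀ ε : ℝ≥0∞, 0 < ε → ∃ M, ∀ n, M ≤ n → ∀ m, M ≤ m →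
      eLpNorm (F n - F m) 2 (volume.restrict (Metric.ball 0 (r k))) < ε) :
    ∃ f : RN N → G, ∀ k, MemLp f 2 (volume.restrict (Metric.ball 0 (r k))) ∧
      Tendsto (fun n => eLpNorm (F n - f) 2 (volume.restrict (Metric.ball 0 (r k)))) atTop
        (𝓝 0) := by
  have h1 : ∀ k, ∃ f : RN N → G, MemLp f 2 (volume.restrict (Metric.ball 0 (r k))) ∧
      Tendsto (fun n => eLpNorm (F n - f) 2 (volume.restrict (Metric.ball 0 (r k)))) atTop
        (𝓝 0) := fun k => by
    have hcau : CauchySeq fun n => (hF k n).toLp := by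
      rw [EMetric.cauchySeq_iff]
      intro ε hε
      obtain ⟨M, hM⟩ := hC k ε hε
      refine ⟨M, fun n hn m hm => ?_⟩
      rw [Lp.edist_toLp_toLp]
      exact hM n hn m hm
    obtain ⟨f, hf⟩ := cauchySeq_tendsto_of_complete hcau
    refine ⟨f, Lp.memLp f, ?_⟩
    rw [Lp.tendsto_Lp_iff_tendsto_eLpNorm'] at hf
    refine hf.congr fun n => eLpNorm_congr_ae ?_
    filter_upwards [(hF k n).coeFn_toLp] with x hx
    rw [Pi.sub_apply, Pi.sub_apply, hx]
  choose f hf hlim using h1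
  have h2 : ∀ k l, ∀ᵐ x : RN N, x ∈ Metric.ball (0 : RN N) (r k) → x ∈ Metric.ball (0 : RN N) (r l) →
      f k x = f l x := by
    have key : ∀ k l, r k ≤ r l → f k =ᵐ[volume.restrict (Metric.ball 0 (r k))] f l :=
      fun k l hkl => by
        have hμ : (volume : Measure (RN N)).restrict (Metric.ball 0 (r k)) ≤
            volume.restrict (Metric.ball 0 (r l)) :=
          Measure.restrict_mono (Metric.ball_subset_ball hkl) le_rfl
        refine ae_eq_of_tendsto_eLpNorm (fun n => (hF k n).1) (hf k).1 ((hf l).1.mono_measure hμ)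
          (hlim k) ?_
        exact tendsto_of_tendsto_of_tendsto_of_le_of_le tendsto_const_nhds (hlim l)
          (fun n => bot_le) fun n => eLpNorm_mono_measure _ hμ
    intro k l
    rcases le_total (r k) (r l) with h | h
    · filter_upwards [(ae_restrict_iff' Metric.isOpen_ball.measurableSet).1 (key k l h)] with x hx
        using fun hk _ => hx hk
    · filter_upwards [(ae_restrict_iff' Metric.isOpen_ball.measurableSet).1 (key l k h)] with x hx
        using fun _ hl => (hx hl).symm
  -- The limits on different balls agree a.e. on overlaps, so they are glued by using, at `x`, the
  -- limit on any ball that contains `x`.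
  choose κ hκ using hr
  have h3 : ∀ k, (fun x => f (κ x) x) =ᵐ[volume.restrict (Metric.ball 0 (r k))] f k := fun k => by
    refine (ae_restrict_iff' Metric.isOpen_ball.measurableSet).2 ?_
    filter_upwards [ae_all_iff.2 fun k => ae_all_iff.2 fun l => h2 k l] with x hx hk
    exact hx (κ x) k (hκ x) hk
  refine ⟨fun x => f (κ x) x, fun k => ⟨(hf k).ae_eq (h3 k).symm, (hlim k).congr fun n => ?_⟩⟩
  refine eLpNorm_congr_ae ?_
  filter_upwards [h3 k] with x hx
  rw [Pi.sub_apply, Pi.sub_apply, hx]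

theorem locallyIntegrable_of_memLp_balls {f : RN N → G} {r : ℕ → ℝ}
    (hr : ∀ x : RN N, ∃ k, x ∈ Metric.ball 0 (r k))
    (hf : ∀ k, MemLp f 2 (volume.restrict (Metric.ball 0 (r k)))) :
    LocallyIntegrable f volume := by
  intro x
  obtain ⟨k, hk⟩ := hr x
  refine ⟨_, Metric.isOpen_ball.mem_nhds hk, ?_⟩
  have : IsFiniteMeasure ((volume : Measure (RN N)).restrict (Metric.ball 0 (r k))) :=
    ⟨by rw [Measure.restrict_apply_univ]; exact measure_ball_lt_top⟩
  exact (hf k).integrable (by norm_num)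

/-- On a ball carrying the bounded factor `φ`, `L²` convergence gives `L¹` convergence. This passes
the defining identity of weak gradients to the limit. -/
theorem tendsto_integral_mul_of_tendsto_eLpNorm {F : ℕ → RN N → ℝ} {f : RN N → ℝ}
    (hF : ∀ n, LocallyIntegrable (F n) volume) (hf : LocallyIntegrable f volume) {R : ℝ}
    (hlim : Tendsto (fun n => eLpNorm (F n - f) 2 (volume.restrict (Metric.ball 0 R))) atTop (𝓝 0))
    {φ : RN N → ℝ} (hφ : Continuous φ) (hc : HasCompactSupport φ)
    (hs : ∀ x, x ∉ Metric.ball 0 R → φ x = 0) :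
    Tendsto (fun n => ∫ x, F n x * φ x) atTop (𝓝 (∫ x, f x * φ x)) := by
  obtain ⟨C, hC, hCb⟩ := HasCompactSupport.exists_bound hφ hc
  refine tendsto_integral_of_L1 _
    (LocallyIntegrable.integrable_mul_compactSupport hf hφ hc).1
    (Filter.Eventually.of_forall fun n =>
      LocallyIntegrable.integrable_mul_compactSupport (hF n) hφ hc) ?_
  set μ := (volume : Measure (RN N)).restrict (Metric.ball 0 R) with hμ
  set B := ENNReal.ofReal C * μ Set.univ ^ (1 / (1 : ℝ≥0∞).toReal - 1 / (2 : ℝ≥0∞).toReal) with hB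
  have hBt : B ≠ ⊤ := by
    refine ENNReal.mul_ne_top ENNReal.ofReal_ne_top (ENNReal.rpow_ne_top_of_nonneg (by norm_num) ?_)
    rw [hμ, Measure.restrict_apply_univ]
    exact measure_ball_lt_top.ne
  have hlim' := ENNReal.Tendsto.const_mul (a := B) hlim (Or.inr hBt)
  rw [mul_zero] at hlim'
  refine tendsto_of_tendsto_of_tendsto_of_le_of_le tendsto_const_nhds hlim'
    (fun n => bot_le) fun n => ?_
  calc ∫⁻ x, ‖F n x * φ x - f x * φ x‖ₑ
      ≤ ∫⁻ x in Metric.ball 0 R, ENNReal.ofReal C * ‖(F n - f) x‖ₑ := by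
        rw [← lintegral_indicator Metric.isOpen_ball.measurableSet]
        refine lintegral_mono fun x => ?_
        by_cases hx : x ∈ Metric.ball 0 R
        · rw [Set.indicator_of_mem hx, ← sub_mul, enorm_mul, mul_comm, Pi.sub_apply]
          refine mul_le_mul' ?_ le_rfl
          rw [← ofReal_norm]
          exact ENNReal.ofReal_le_ofReal (hCb x)
        · simp [hs x hx]
    _ = ENNReal.ofReal C * eLpNorm (F n - f) 1 μ := by
        rw [lintegral_const_mul' _ _ ENNReal.ofReal_ne_top, eLpNorm_one_eq_lintegral_enorm]
    _ ≤ ENNReal.ofReal C * (eLpNorm (F n - f) 2 μ *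
          μ Set.univ ^ (1 / (1 : ℝ≥0∞).toReal - 1 / (2 : ℝ≥0∞).toReal)) := by
        refine mul_le_mul' le_rfl (eLpNorm_le_eLpNorm_mul_rpow_measure_univ (by norm_num) ?_)
        exact ((hF n).aestronglyMeasurable.sub hf.aestronglyMeasurable).restrict
    _ = B * eLpNorm (F n - f) 2 μ := by rw [hB]; ring

end LimitOnBalls

/-! ### The energy space and its completeness -/

section EnergySpace

variable {N : ℕ} {σ : ℝ} {Ω : Set (RN N)} {u v : RN N → ℝ} {U V : RN N → RN N}

/-- The Hilbert space `L²(Ω) × L²(Q(Ω))`. -/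
abbrev EnergyTarget (Ω : Set (RN N)) : Type :=
  WithLp 2 (Lp ℝ 2 (volume.restrict Ω) × Lp (RN N) 2 (qMeasure Ω))

/-- `w` is the image of the function `u`, with weak gradient `U`, of the energy space. -/
structure Represents (σ : ℝ) (Ω : Set (RN N)) (w : EnergyTarget Ω) (u : RN N → ℝ)
    (U : RN N → RN N) : Prop where
  weakGrad : HasWeakGradient u U
  fst : w.fst =ᵐ[volume.restrict Ω] u
  snd : w.snd =ᵐ[qMeasure Ω] gagliardoDiff σ U

namespace Represents

variable {w z : EnergyTarget Ω}

theorem add (hw : Represents σ Ω w u U) (hz : Represents σ Ω z v V) :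
    Represents σ Ω (w + z) (u + v) (U + V) where
  weakGrad := hw.weakGrad.add hz.weakGrad
  fst := (Lp.coeFn_add w.fst z.fst).trans (hw.fst.add hz.fst)
  snd := by
    rw [gagliardoDiff_add]
    exact (Lp.coeFn_add w.snd z.snd).trans (hw.snd.add hz.snd)

theorem smul (hw : Represents σ Ω w u U) (c : ℝ) :
    Represents σ Ω (c • w) (c • u) (c • U) where
  weakGrad := hw.weakGrad.smul c
  fst := (Lp.coeFn_smul c w.fst).trans (hw.fst.const_smul c)
  snd := by
    rw [gagliardoDiff_smul]
    exact (Lp.coeFn_smul c w.snd).trans (hw.snd.const_smul c)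

theorem sub (hw : Represents σ Ω w u U) (hz : Represents σ Ω z v V) :
    Represents σ Ω (w - z) (u - v) (U - V) := by
  have := hw.add (hz.smul (-1))
  simpa [sub_eq_add_neg] using this

theorem enorm_sq (hw : Represents σ Ω w u U) :
    ‖w‖ₑ ^ 2 = (∫⁻ x in Ω, ‖u x‖ₑ ^ 2) + fieldEnergy σ Ω U := by
  rw [enorm_sq_eq_ofReal, WithLp.prod_norm_sq_eq_of_L2, ENNReal.ofReal_add (sq_nonneg _)
    (sq_nonneg _), ← enorm_sq_eq_ofReal, ← enorm_sq_eq_ofReal, Lp.enorm_def, Lp.enorm_def,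
    eLpNorm_congr_ae hw.fst, eLpNorm_congr_ae hw.snd, eLpNorm_two_sq, eLpNorm_two_sq, fieldEnergy]

theorem memHsN (hw : Represents σ Ω w u U) : MemHsN σ Ω 0 u where
  weakDiff := ⟨U, hw.weakGrad⟩
  energy_lt_top := by
    have h := (memLp_two_iff_lintegral (Lp.memLp w.snd).1).1 (Lp.memLp w.snd)
    rw [energy_eq hw.weakGrad, fieldEnergy]
    refine (lintegral_congr_ae ?_).trans_lt h
    filter_upwards [hw.snd] with x hx
    rw [hx]
  memLp := (memLp_congr_ae hw.fst).1 (Lp.memLp w.fst)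
  integrable_ext := by simp

end Represents

theorem MemHsN.fieldEnergy_lt_top (h : MemHsN σ Ω 0 u) :
    fieldEnergy σ Ω (weakGradient u) < ⊤ := by
  rw [← energy_eq h.weakDiff.hasWeakGradient]
  exact h.energy_lt_top

theorem memLp_gagliardoDiff (hU : AEStronglyMeasurable U volume)
    (h : fieldEnergy σ Ω U < ⊤) : MemLp (gagliardoDiff σ U) 2 (qMeasure Ω) :=
  (memLp_two_iff_lintegral (aestronglyMeasurable_gagliardoDiff hU).restrict).2 h

theorem MemHsN.exists_represents (h : MemHsN σ Ω 0 u) :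
    ∃ w : EnergyTarget Ω, Represents σ Ω w u (weakGradient u) := by
  have hg := h.weakDiff.hasWeakGradient
  have h2 := memLp_gagliardoDiff hg.locIntGrad.aestronglyMeasurable h.fieldEnergy_lt_top
  exact ⟨WithLp.toLp 2 (h.memLp.toLp, h2.toLp), hg, h.memLp.coeFn_toLp, h2.coeFn_toLp⟩

/-- The energy space, as a subspace of `L²(Ω) × L²(Q(Ω))`. -/
noncomputable def energySpace (σ : ℝ) (Ω : Set (RN N)) : Submodule ℝ (EnergyTarget Ω) where
  carrier := {w | ∃ u U, Represents σ Ω w u U}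
  add_mem' := by
    rintro w z ⟨u, U, hw⟩ ⟨v, V, hz⟩
    exact ⟨_, _, hw.add hz⟩
  zero_mem' := by
    refine ⟨0, 0, ?_, Lp.coeFn_zero _ _ _, ?_⟩
    · have := hasWeakGradient_affine (N := N) 0 0
      simpa using! this
    · have : gagliardoDiff σ (0 : RN N → RN N) = 0 := by ext1 z; simp [gagliardoDiff]
      rw [this]
      exact Lp.coeFn_zero _ _ _
  smul_mem' := by
    rintro c w ⟨u, U, hw⟩
    exact ⟨_, _, hw.smul c⟩

/-- The two convergences live on different measure spaces, so the limits are compared pointwise: a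
subsequence for `F n → f`, then a further one along which the weighted differences converge a.e. to
`g`. -/
theorem tendsto_gagliardoDiff_unique {F : ℕ → RN N → RN N} {f : RN N → RN N}
    {g : RN N × RN N → RN N} {R : ℝ}
    (hF : ∀ n, AEStronglyMeasurable (F n) volume) (hf : AEStronglyMeasurable f volume)
    (hg : AEStronglyMeasurable g (qMeasure Ω))
    (h1 : Tendsto (fun n => eLpNorm (F n - f) 2 (volume.restrict (Metric.ball 0 R))) atTop (𝓝 0))
    (h2 : Tendsto (fun n => eLpNorm (gagliardoDiff σ (F n) - g) 2 (qMeasure Ω)) atTop (𝓝 0)) :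
    ∀ᵐ z ∂(qMeasure Ω), z.1 ∈ Metric.ball 0 R → z.2 ∈ Metric.ball 0 R →
      g z = gagliardoDiff σ f z := by
  obtain ⟨ns, hns, hlim⟩ := (tendstoInMeasure_of_tendsto_eLpNorm two_ne_zero
    (fun n => (hF n).restrict) hf.restrict h1).exists_seq_tendsto_ae
  have hm := tendstoInMeasure_of_tendsto_eLpNorm two_ne_zero
    (fun n => (aestronglyMeasurable_gagliardoDiff (hF n)).restrict) hg h2
  obtain ⟨ns', hns', hlim'⟩ := (hm.comp hns.tendsto_atTop).exists_seq_tendsto_ae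
  have hl := (ae_restrict_iff' Metric.isOpen_ball.measurableSet).1 hlim
  have hl1 : ∀ᵐ z ∂(qMeasure Ω), z.1 ∈ Metric.ball 0 R →
      Tendsto (fun i => F (ns i) z.1) atTop (𝓝 (f z.1)) :=
    ae_restrict_of_ae (Measure.quasiMeasurePreserving_fst.ae hl)
  have hl2 : ∀ᵐ z ∂(qMeasure Ω), z.2 ∈ Metric.ball 0 R →
      Tendsto (fun i => F (ns i) z.2) atTop (𝓝 (f z.2)) :=
    ae_restrict_of_ae (Measure.quasiMeasurePreserving_snd.ae hl)
  filter_upwards [hl1, hl2, hlim'] with z hz1 hz2 hz hm1 hm2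
  refine tendsto_nhds_unique hz ?_
  exact (((hz1 hm1).comp hns'.tendsto_atTop).sub
    ((hz2 hm2).comp hns'.tendsto_atTop)).const_smul _

/-- Turns a bound on squared norms into the Cauchy condition, by continuity of `d ↦ C d²` at zero.
-/
theorem eLpNorm_lt_of_lintegral_sq_le {α G : Type*} [MeasurableSpace α] [NormedAddCommGroup G]
    {μ : Measure α} {C : ℝ≥0∞} (hC : C ≠ ⊤) {ε : ℝ≥0∞} (hε : 0 < ε) :
    ∃ δ : ℝ≥0∞, 0 < δ ∧ ∀ (f : α → G) (d : ℝ≥0∞), ∫⁻ x, ‖f x‖ₑ ^ 2 ∂μ ≤ C * d ^ 2 → d < δ →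
      eLpNorm f 2 μ < ε := by
  have hlim : Tendsto (fun d : ℝ≥0∞ => C * d ^ 2) (𝓝 0) (𝓝 0) := by
    have h1 := ENNReal.Tendsto.const_mul (a := C)
      ((ENNReal.continuous_pow 2).tendsto (0 : ℝ≥0∞)) (Or.inr hC)
    simpa using h1
  have hev := hlim.eventually (gt_mem_nhds (show (0 : ℝ≥0∞) < ε ^ 2 from by positivity))
  obtain ⟨δ, hδ, hδ'⟩ := ENNReal.nhds_zero_basis.eventually_iff.1 hev
  refine ⟨δ, hδ, fun f d hd hdδ => ?_⟩
  have h2 : eLpNorm f 2 μ ^ 2 < ε ^ 2 := by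
    rw [eLpNorm_two_sq]
    exact hd.trans_lt (hδ' hdδ)
  exact lt_of_not_ge fun hge => absurd (pow_le_pow_left' hge 2) (not_le.2 h2)

/-- Convergence in the energy norm makes functions and gradients Cauchy in `L²` of every ball. Their
local limits are again a function and its weak gradient, and represent the limit pair. -/
theorem isClosed_energySpace (hσ : 0 < σ) (hΩ : IsOpen Ω) (hne : Ω.Nonempty)
    (hb : Bornology.IsBounded Ω) : IsClosed (energySpace σ Ω : Set (EnergyTarget Ω)) := by
  refine IsSeqClosed.isClosed fun w wlim hw hlim => ?_
  choose u U hrep using hw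
  obtain ⟨R₀, hR₀⟩ := hb.subset_ball (0 : RN N)
  set r : ℕ → ℝ := fun k => R₀ + k with hrdef
  have hr : ∀ x : RN N, ∃ k, x ∈ Metric.ball 0 (r k) := fun x => by
    obtain ⟨k, hk⟩ := exists_nat_gt (‖x‖ - R₀)
    exact ⟨k, mem_ball_zero_iff.2 (by simp only [hrdef]; linarith)⟩
  have hΩr : ∀ k, Ω ⊆ Metric.ball 0 (r k) := fun k =>
    hR₀.trans (Metric.ball_subset_ball (by simp [hrdef]))
  have hgrad := fun k => exists_lintegral_gradient_le hσ hΩ hne (hΩr k)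
  have hfun := fun k => exists_lintegral_le hσ hΩ hne (hΩr k)
  choose C₁ hC₁ hb₁ using hgrad
  choose C₂ hC₂ hb₂ using hfun
  have hUm : ∀ n, AEStronglyMeasurable (U n) volume := fun n =>
    (hrep n).weakGrad.locIntGrad.aestronglyMeasurable
  have hum : ∀ n, AEStronglyMeasurable (u n) volume := fun n =>
    (hrep n).weakGrad.locInt.aestronglyMeasurable
  have hUL : ∀ k n, MemLp (U n) 2 (volume.restrict (Metric.ball 0 (r k))) := fun k n => by
    rw [memLp_two_iff_lintegral (hUm n).restrict]
    refine (hb₁ k (hrep n).weakGrad).trans_lt ?_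
    rw [← (hrep n).enorm_sq]
    have := hC₁ k
    finiteness
  have huL : ∀ k n, MemLp (u n) 2 (volume.restrict (Metric.ball 0 (r k))) := fun k n => by
    rw [memLp_two_iff_lintegral (hum n).restrict]
    refine (hb₂ k (hrep n).weakGrad).trans_lt ?_
    rw [← (hrep n).enorm_sq]
    have := hC₂ k
    finiteness
  have hcau := EMetric.cauchySeq_iff.1 hlim.cauchySeq
  obtain ⟨Ul, hUl⟩ := exists_limit_on_balls hr hUL fun k ε hε => by
    obtain ⟨δ, hδ, hδ'⟩ := eLpNorm_lt_of_lintegral_sq_le (G := RN N)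
      (μ := volume.restrict (Metric.ball (0 : RN N) (r k))) (hC₁ k) hε
    obtain ⟨M, hM⟩ := hcau δ hδ
    refine ⟨M, fun n hn m hm => hδ' _ (edist (w n) (w m)) ?_ (hM n hn m hm)⟩
    have h := (hrep n).sub (hrep m)
    rw [edist_eq_enorm_sub, h.enorm_sq]
    exact hb₁ k h.weakGrad
  obtain ⟨ul, hul⟩ := exists_limit_on_balls hr huL fun k ε hε => by
    obtain ⟨δ, hδ, hδ'⟩ := eLpNorm_lt_of_lintegral_sq_le (G := ℝ)
      (μ := volume.restrict (Metric.ball (0 : RN N) (r k))) (hC₂ k) hε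
    obtain ⟨M, hM⟩ := hcau δ hδ
    refine ⟨M, fun n hn m hm => hδ' _ (edist (w n) (w m)) ?_ (hM n hn m hm)⟩
    have h := (hrep n).sub (hrep m)
    rw [edist_eq_enorm_sub, h.enorm_sq]
    exact hb₂ k h.weakGrad
  have hUloc := locallyIntegrable_of_memLp_balls hr fun k => (hUl k).1
  have huloc := locallyIntegrable_of_memLp_balls hr fun k => (hul k).1
  have hfst : Tendsto (fun n => (w n).fst) atTop (𝓝 wlim.fst) :=
    ((WithLp.fstL 2 ℝ (Lp ℝ 2 (volume.restrict Ω)) (Lp (RN N) 2 (qMeasure Ω))).continuous.tendsto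
      wlim).comp hlim
  have hsnd : Tendsto (fun n => (w n).snd) atTop (𝓝 wlim.snd) :=
    ((WithLp.sndL 2 ℝ (Lp ℝ 2 (volume.restrict Ω)) (Lp (RN N) 2 (qMeasure Ω))).continuous.tendsto
      wlim).comp hlim
  rw [Lp.tendsto_Lp_iff_tendsto_eLpNorm'] at hfst hsnd
  have hfst' : Tendsto (fun n => eLpNorm (u n - (wlim.fst : RN N → ℝ)) 2 (volume.restrict Ω)) atTop (𝓝 0) :=
    hfst.congr fun n => eLpNorm_congr_ae ((hrep n).fst.sub (ae_eq_refl _))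
  have hsnd' : Tendsto (fun n => eLpNorm (gagliardoDiff σ (U n) -
      (wlim.snd : RN N × RN N → RN N)) 2 (qMeasure Ω)) atTop (𝓝 0) := hsnd.congr fun n => eLpNorm_congr_ae ((hrep n).snd.sub (ae_eq_refl _))
  refine ⟨ul, Ul, ⟨huloc, hUloc, fun φ hφ hc i => ?_⟩, ?_, ?_⟩
  · obtain ⟨R, hR, hR0⟩ := HasCompactSupport.exists_ball hc
    obtain ⟨k, hk⟩ := exists_nat_gt (R - R₀)
    -- The strict inequality puts the closed support of `φ`, hence that of its derivative, inside an
    -- open ball of the exhaustion.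
    have hRk : R < r k := by simp only [hrdef]; linarith
    have hφ0 : ∀ x, x ∉ Metric.ball 0 (r k) → φ x = 0 := fun x hx => by
      rw [mem_ball_zero_iff, not_lt] at hx
      exact hR0 x (hRk.le.trans hx)
    have hts : tsupport φ ⊆ Metric.closedBall 0 R :=
      closure_minimal (fun x hx => by
        by_contra hcon
        rw [mem_closedBall_zero_iff, not_le] at hcon
        exact hx (hR0 x hcon.le)) Metric.isClosed_closedBall
    have hd0 : ∀ x, x ∉ Metric.ball 0 (r k) →
        fderiv ℝ φ x (EuclideanSpace.single i 1) = 0 := fun x hx => by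
      have : fderiv ℝ φ x = 0 := image_eq_zero_of_notMem_tsupport fun h => hx <|
        Metric.closedBall_subset_ball hRk (hts (tsupport_fderiv_subset ℝ h))
      simp [this]
    have hlimU : Tendsto (fun n => eLpNorm ((fun x => U n x i) - fun x => Ul x i) 2
        (volume.restrict (Metric.ball 0 (r k)))) atTop (𝓝 0) :=
      tendsto_of_tendsto_of_tendsto_of_le_of_le tendsto_const_nhds (hUl k).2 (fun n => bot_le)
        fun n => eLpNorm_mono fun x => PiLp.norm_apply_le ((U n - Ul) x) i
    have t1 := tendsto_integral_mul_of_tendsto_eLpNorm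
      (fun n => LocallyIntegrable.coord (hrep n).weakGrad.locIntGrad i)
      (LocallyIntegrable.coord hUloc i) hlimU hφ.continuous hc hφ0
    have t2 := tendsto_integral_mul_of_tendsto_eLpNorm (fun n => (hrep n).weakGrad.locInt)
      huloc (hul k).2 (continuous_fderiv_apply_of_test hφ (EuclideanSpace.single i 1))
      (hc.fderiv_apply ℝ _) hd0
    exact tendsto_nhds_unique t1 (t2.neg.congr fun n => ((hrep n).weakGrad.parts φ hφ hc i).symm)
  · refine ae_eq_of_tendsto_eLpNorm (fun n => (hum n).restrict) (Lp.aestronglyMeasurable _)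
      huloc.aestronglyMeasurable.restrict hfst' ?_
    exact tendsto_of_tendsto_of_tendsto_of_le_of_le tendsto_const_nhds (hul 0).2
      (fun n => bot_le) fun n => eLpNorm_mono_measure _ (Measure.restrict_mono (hΩr 0) le_rfl)
  · have h := fun k => tendsto_gagliardoDiff_unique hUm hUloc.aestronglyMeasurable
      (Lp.aestronglyMeasurable wlim.snd) (hUl k).2 hsnd'
    filter_upwards [ae_all_iff.2 h] with z hz
    obtain ⟨k, hk⟩ := hr z.1
    obtain ⟨l, hl⟩ := hr z.2
    have hmono : ∀ {a b : ℕ}, a ≤ b → Metric.ball (0 : RN N) (r a) ⊆ Metric.ball 0 (r b) :=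
      fun hab => Metric.ball_subset_ball (by simp only [hrdef]; gcongr)
    exact hz (max k l) (hmono (le_max_left _ _) hk) (hmono (le_max_right _ _) hl)

end EnergySpace

/-! ### Compactness of the restriction to `L²(Ω)` -/

section Compactness

/-- The approximants of the unit ball stay in a bounded, hence totally bounded, part of a
finite-dimensional space, so the image of the unit ball is totally bounded. -/
theorem isCompactOperator_of_finiteDimensional_approx {V L : Type*} [NormedAddCommGroup V]
    [NormedSpace ℝ V] [NormedAddCommGroup L] [NormedSpace ℝ L] [CompleteSpace L] (T : V →L[ℝ] L)
    (h : ∀ ε : ℝ, 0 < ε → ∃ W : Submodule ℝ L, FiniteDimensional ℝ W ∧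
      ∀ v : V, ‖v‖ ≤ 1 → ∃ y ∈ W, ‖T v - y‖ ≤ ε) : IsCompactOperator T := by
  rw [isCompactOperator_iff_exists_mem_nhds_isCompact_closure_image]
  refine ⟨Metric.ball 0 1, Metric.ball_mem_nhds _ one_pos, ?_⟩
  refine TotallyBounded.isCompact_of_isClosed (TotallyBounded.closure ?_) isClosed_closure
  rw [Metric.totallyBounded_iff]
  intro ε hε
  obtain ⟨W, hW, happ⟩ := h (ε / 2) (by positivity)
  set M := ‖T‖ + ε / 2 with hM
  have hK : IsCompact ((↑) '' (Metric.closedBall (0 : W) M) : Set L) := by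
    have : ProperSpace W := FiniteDimensional.proper ℝ W
    exact (isCompact_closedBall _ _).image continuous_subtype_val
  obtain ⟨t, ht, hcov⟩ := Metric.totallyBounded_iff.1 hK.totallyBounded (ε / 2) (by positivity)
  refine ⟨t, ht, ?_⟩
  rintro _ ⟨v, hv, rfl⟩
  have hv1 : ‖v‖ ≤ 1 := (mem_ball_zero_iff.1 hv).le
  obtain ⟨y, hy, hyv⟩ := happ v hv1
  have hyM : ‖y‖ ≤ M := by
    have h1 : ‖y‖ ≤ ‖T v‖ + ‖T v - y‖ := by
      have := norm_sub_le (T v) (T v - y)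
      simpa using this
    have h2 : ‖T v‖ ≤ ‖T‖ := by simpa using T.le_opNorm_of_le hv1
    linarith
  have hyK : y ∈ ((↑) '' (Metric.closedBall (0 : W) M) : Set L) :=
    ⟨⟨y, hy⟩, by simpa using hyM, rfl⟩
  obtain ⟨z, hz, hzy⟩ := Set.mem_iUnion₂.1 (hcov hyK)
  refine Set.mem_iUnion₂.2 ⟨z, hz, ?_⟩
  rw [Metric.mem_ball] at hzy ⊢
  calc dist (T v) z ≤ dist (T v) y + dist y z := dist_triangle _ _ _
    _ < ε := by rw [dist_eq_norm (T v) y]; linarith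

variable {N : ℕ} {σ : ℝ} {Ω : Set (RN N)} {u : RN N → ℝ} {U : RN N → RN N}

/-- A measurable choice of a nearby point, among finitely many. -/
theorem exists_measurable_net (hb : Bornology.IsBounded Ω) {δ : ℝ} (hδ : 0 < δ) :
    ∃ (n : ℕ) (e : Fin n → RN N) (j : RN N → Fin n), Measurable j ∧
      ∀ x ∈ Ω, x ∈ Metric.ball (e (j x)) δ := by
  set d := TopologicalSpace.denseSeq (RN N)
  obtain ⟨t, ht⟩ := hb.isCompact_closure.elim_finite_subcover
    (fun k => Metric.ball (d k) δ) (fun k => Metric.isOpen_ball) fun x _ => by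
      obtain ⟨k, hk⟩ := (TopologicalSpace.denseRange_denseSeq (RN N)).exists_dist_lt x hδ
      exact Set.mem_iUnion.2 ⟨k, hk⟩
  obtain ⟨n, hn⟩ := t.bddAbove
  -- The nearest point is sought among the indices `0, …, n`, where `n` bounds the indices of the
  -- subcover; it is at least as near as the centre of the covering ball.
  refine ⟨n + 1, fun k => d k, fun x => ⟨SimpleFunc.nearestPtInd d n x,
    Nat.lt_succ_of_le (SimpleFunc.nearestPtInd_le d n x)⟩, ?_, fun x hx => ?_⟩
  · refine measurable_to_countable' fun k => ?_
    convert (SimpleFunc.nearestPtInd d n).measurableSet_fiber k using 1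
    ext x
    simp [Fin.ext_iff]
  · obtain ⟨k, hk, hxk⟩ := Set.mem_iUnion₂.1 (ht (subset_closure hx))
    have h1 := SimpleFunc.edist_nearestPt_le d x (hn hk)
    rw [Metric.mem_ball, dist_comm] at hxk ⊢
    refine lt_of_le_of_lt ?_ hxk
    rw [edist_dist, edist_dist, ENNReal.ofReal_le_ofReal_iff dist_nonneg] at h1
    exact h1

theorem memLp_comp_fin (hb : Bornology.IsBounded Ω) {n : ℕ} {j : RN N → Fin n}
    (hj : Measurable j) (c : Fin n → ℝ) :
    MemLp (fun x => c (j x)) 2 (volume.restrict Ω) := by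
  have : IsFiniteMeasure ((volume : Measure (RN N)).restrict Ω) :=
    ⟨by rw [Measure.restrict_apply_univ]; exact hb.measure_lt_top⟩
  exact MemLp.of_bound ((measurable_of_finite c).comp hj).aestronglyMeasurable ‖c‖
    (Filter.Eventually.of_forall fun x => norm_le_pi_norm c (j x))

/-- The functions of `L²(Ω)` that are constant on the pieces of a finite measurable partition. -/
noncomputable def stepFunctions (hb : Bornology.IsBounded Ω) {n : ℕ} {j : RN N → Fin n}
    (hj : Measurable j) : (Fin n → ℝ) →ₗ[ℝ] Lp ℝ 2 (volume.restrict Ω) where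
  toFun c := (memLp_comp_fin hb hj c).toLp
  map_add' c c' := by rw [← MemLp.toLp_add]; rfl
  map_smul' a c := by rw [RingHom.id_apply, ← MemLp.toLp_const_smul]; rfl

theorem stepFunctions_ae (hb : Bornology.IsBounded Ω) {n : ℕ} {j : RN N → Fin n}
    (hj : Measurable j) (c : Fin n → ℝ) :
    stepFunctions hb hj c =ᵐ[volume.restrict Ω] fun x => c (j x) :=
  (memLp_comp_fin hb hj c).coeFn_toLp

/-- The restriction to `Ω` of the elements of the energy space. -/
noncomputable def energyEmbedding (σ : ℝ) (Ω : Set (RN N)) :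
    energySpace σ Ω →L[ℝ] Lp ℝ 2 (volume.restrict Ω) :=
  (WithLp.fstL 2 ℝ (Lp ℝ 2 (volume.restrict Ω)) (Lp (RN N) 2 (qMeasure Ω))).comp
    (energySpace σ Ω).subtypeL

theorem energyEmbedding_ae {w : energySpace σ Ω} (hw : Represents σ Ω w u U) :
    energyEmbedding σ Ω w =ᵐ[volume.restrict Ω] u := hw.fst

theorem Represents.enorm_sub_stepFunctions_sq_le {w : energySpace σ Ω}
    (hw : Represents σ Ω w u U) (hΩ : IsOpen Ω) (hb : Bornology.IsBounded Ω) {R δ : ℝ} (hδ : 0 < δ)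
    (hR : Ω ⊆ Metric.ball 0 R) {n : ℕ} {e : Fin n → RN N} {j : RN N → Fin n} (hj : Measurable j)
    (hnet : ∀ x ∈ Ω, x ∈ Metric.ball (e (j x)) δ) :
    ‖energyEmbedding σ Ω w -
        stepFunctions hb hj (fun k => ⨍ y in Metric.ball (e k) δ, u y)‖ₑ ^ 2 ≤
      ENNReal.ofReal (2 ^ (N + 2) * δ ^ 2) *
        ∫⁻ x in Metric.ball 0 (R + 2 * δ), ‖U x‖ₑ ^ 2 := by
  refine le_trans (le_of_eq ?_)
    (hw.weakGrad.lintegral_sub_average_le hΩ.measurableSet hδ hR hnet)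
  rw [Lp.enorm_def, eLpNorm_two_sq]
  refine lintegral_congr_ae ?_
  filter_upwards [Lp.coeFn_sub (energyEmbedding σ Ω w)
    (stepFunctions hb hj (fun k => ⨍ y in Metric.ball (e k) δ, u y)),
    stepFunctions_ae hb hj (fun k => ⨍ y in Metric.ball (e k) δ, u y),
    energyEmbedding_ae hw] with x h1 h2 h3
  rw [h1, Pi.sub_apply, h2, h3]

theorem exists_small_radius (N : ℕ) (c : ℝ) {ε : ℝ} (hε : 0 < ε) :
    ∃ δ : ℝ, 0 < δ ∧ δ ≤ 1 ∧ 2 ^ (N + 2) * δ ^ 2 * c ≤ ε ^ 2 := by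
  have hlim : Tendsto (fun δ : ℝ => 2 ^ (N + 2) * δ ^ 2 * c) (𝓝[>] 0) (𝓝 0) := by
    have : Continuous fun δ : ℝ => 2 ^ (N + 2) * δ ^ 2 * c := by fun_prop
    have h := this.tendsto 0
    simp only [ne_eq, OfNat.ofNat_ne_zero, not_false_eq_true, zero_pow, mul_zero,
      zero_mul] at h
    exact h.mono_left nhdsWithin_le_nhds
  have h1 := hlim.eventually (ge_mem_nhds (show (0 : ℝ) < ε ^ 2 by positivity))
  have h2 : ∀ᶠ δ : ℝ in 𝓝[>] 0, δ ≤ 1 := nhdsWithin_le_nhds (ge_mem_nhds one_pos)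
  obtain ⟨δ, ⟨h3, h4⟩, h5⟩ := ((h1.and h2).and self_mem_nhdsWithin).exists
  exact ⟨δ, h5, h4, h3⟩

/-- Averages over a finite `δ`-net give step functions within `O(δ)` of `u` in `L²(Ω)`, uniformly on
the unit ball, because the energy norm bounds the gradient on a ball larger than `Ω`. -/
theorem isCompactOperator_energyEmbedding (hσ : 0 < σ) (hΩ : IsOpen Ω) (hne : Ω.Nonempty)
    (hb : Bornology.IsBounded Ω) : IsCompactOperator (energyEmbedding σ Ω) := by
  refine isCompactOperator_of_finiteDimensional_approx _ fun ε hε => ?_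
  obtain ⟨R, hR⟩ := hb.subset_ball (0 : RN N)
  -- Radius `R + 2` covers `R + 2 * δ` for all `δ ≤ 1`, so `C` is fixed before `δ` is chosen.
  have hR2 : Metric.ball (0 : RN N) R ⊆ Metric.ball 0 (R + 2) :=
    Metric.ball_subset_ball (by linarith)
  obtain ⟨C, hC, hbound⟩ := exists_lintegral_gradient_le hσ hΩ hne (hR.trans hR2)
  obtain ⟨δ, hδ, hδ1, hδε⟩ := exists_small_radius N C.toReal hε
  obtain ⟨n, e, j, hj, hnet⟩ := exists_measurable_net hb hδ
  refine ⟨LinearMap.range (stepFunctions hb hj),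
    LinearMap.finiteDimensional_range (stepFunctions hb hj), fun w hw => ?_⟩
  obtain ⟨u, U, hrep⟩ := w.2
  refine ⟨_, LinearMap.mem_range_self _ (fun k => ⨍ y in Metric.ball (e k) δ, u y), ?_⟩
  have h1 := hrep.enorm_sub_stepFunctions_sq_le hΩ hb hδ hR hj hnet
  have h2 : ∫⁻ x in Metric.ball 0 (R + 2 * δ), ‖U x‖ₑ ^ 2 ≤ C := by
    refine (lintegral_mono_set (Metric.ball_subset_ball (by linarith))).trans
      ((hbound hrep.weakGrad).trans ?_)
    rw [← hrep.enorm_sq, enorm_sq_eq_ofReal]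
    refine mul_le_of_le_one_right' ?_
    rw [← ENNReal.ofReal_one]
    exact ENNReal.ofReal_le_ofReal (pow_le_one₀ (norm_nonneg _) hw)
  have h3 : ENNReal.ofReal (2 ^ (N + 2) * δ ^ 2) * C ≤ ENNReal.ofReal (ε ^ 2) := by
    rw [← ENNReal.ofReal_toReal hC, ← ENNReal.ofReal_mul (by positivity)]
    exact ENNReal.ofReal_le_ofReal hδε
  have h4 := h1.trans ((mul_le_mul' le_rfl h2).trans h3)
  rw [enorm_sq_eq_ofReal, ENNReal.ofReal_le_ofReal_iff (by positivity)] at h4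
  exact (pow_le_pow_iff_left₀ (norm_nonneg _) hε.le two_ne_zero).1 h4

end Compactness

/-! ### The abstract variational eigenvalue problem -/

section Variational

variable {V L : Type*} [NormedAddCommGroup V] [InnerProductSpace ℝ V] [NormedAddCommGroup L]
  [InnerProductSpace ℝ L]

theorem inner_eq_zero_of_variational {T : V →L[ℝ] L} {w w' : V} {κ κ' : ℝ}
    (h : ∀ z, ⟪w, z⟫ = κ * ⟪T w, T z⟫) (h' : ∀ z, ⟪w', z⟫ = κ' * ⟪T w', T z⟫) (hne : κ ≠ κ') :
    ⟪T w, T w'⟫ = 0 := by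
  have h1 := h w'
  have h2 := h' w
  rw [real_inner_comm, real_inner_comm (T w)] at h2
  have h3 : (κ - κ') * ⟪T w, T w'⟫ = 0 := by rw [sub_mul, ← h1, ← h2, sub_self]
  exact (mul_eq_zero.1 h3).resolve_left (sub_ne_zero.2 hne)

/-- Spectral decomposition for the variational eigenvalue problem `⟪w, ·⟫ = κ ⟪T w, T ·⟫`. -/
theorem exists_variational_eigenbasis [CompleteSpace V] [CompleteSpace L] (T : V →L[ℝ] L)
    (hT : IsCompactOperator T) (hdense : ∀ f, (∀ w, ⟪T w, f⟫ = 0) → f = 0)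
    (hinf : ¬ FiniteDimensional ℝ L) (hle : ∀ w, ‖T w‖ ≤ ‖w‖) :
    ∃ (κ : ℕ → ℝ) (w : ℕ → V), Orthonormal ℝ (fun i => T (w i)) ∧
      (∀ i z, ⟪w i, z⟫ = κ i * ⟪T (w i), T z⟫) ∧ (∀ i, 1 < κ i) ∧ Monotone κ ∧
      Tendsto κ atTop atTop ∧
      (∀ v, v ≠ 0 → ∀ μ, μ ≠ 1 → (∀ z, ⟪v, z⟫ = μ * ⟪T v, T z⟫) → ∃ i, κ i = μ) ∧
      (Submodule.span ℝ (Set.range fun i => T (w i)) ⊔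
        Submodule.span ℝ (T '' {v | ∀ z, ⟪v, z⟫ = ⟪T v, T z⟫})).topologicalClosure = ⊤ := by
  -- The equation says `w = κ S T w`, so `T w` is an eigenvector of `T S` with eigenvalue `1/κ`.
  -- Working in `L` is essential: dense range makes `T S` injective, whereas `S T` kills every
  -- element of the kernel of `T`.
  set S := T.adjoint with hS
  set A : L →L[ℝ] L := T.comp S with hA
  have hSinner : ∀ f z, ⟪S f, z⟫ = ⟪f, T z⟫ := fun f z => T.adjoint_inner_left z f
  have hAinner : ∀ f, ⟪A f, f⟫ = ‖S f‖ ^ 2 := fun f => by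
    rw [hA, ContinuousLinearMap.comp_apply, real_inner_comm, ← hSinner,
      real_inner_self_eq_norm_sq]
  have hAc : IsCompactOperator A := hT.comp_clm S
  have hAs : A.toLinearMap.IsSymmetric := fun f g => by
    change ⟪T (S f), g⟫ = ⟪f, T (S g)⟫
    rw [real_inner_comm, ← hSinner, ← hSinner, real_inner_comm]
  have hpos : ∀ f, f ≠ 0 → 0 < ⟪A f, f⟫ := fun f hf => by
    rw [hAinner]
    have : S f ≠ 0 := fun h0 => hf (hdense f fun w => by
      rw [real_inner_comm, ← hSinner, h0, inner_zero_left])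
    positivity
  have hSle : ∀ f, ‖S f‖ ≤ ‖f‖ := fun f => by
    have h1 : ‖S f‖ ^ 2 ≤ ‖f‖ * ‖S f‖ := by
      rw [← real_inner_self_eq_norm_sq, hSinner]
      exact (real_inner_le_norm _ _).trans (mul_le_mul_of_nonneg_left (hle _) (norm_nonneg _))
    by_contra hcon
    rw [not_le] at hcon
    nlinarith [norm_nonneg f]
  obtain ⟨m, b, hb, hAb, hm0, hm1, hanti, hlim, hall, hcl⟩ :=
    exists_eigenbasis_nat A hAc hAs hpos hinf one_ne_zero
  -- The scaling makes the solutions in `V` lie exactly over the orthonormal eigenvectors in `L`.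
  have hTw : ∀ i, T ((m i)⁻¹ • S (b i)) = b i := fun i => by
    rw [map_smul]
    change (m i)⁻¹ • A (b i) = b i
    rw [hAb, smul_smul, inv_mul_cancel₀ (hm0 i).ne', one_smul]
  -- Here `m i = ‖S (b i)‖² ≤ 1`, and the value `1` was set aside.
  have hmlt : ∀ i, m i < 1 := fun i => by
    refine lt_of_le_of_ne ?_ (hm1 i)
    have h1 := hAinner (b i)
    rw [hAb, real_inner_smul_left, real_inner_self_eq_norm_sq, hb.1 i] at h1
    have h2 := hSle (b i)
    rw [hb.1 i] at h2
    nlinarith [norm_nonneg (S (b i))]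
  refine ⟨fun i => (m i)⁻¹, fun i => (m i)⁻¹ • S (b i), ?_, fun i z => ?_, fun i => ?_,
    fun i k hik => ?_, ?_, fun v hv μ hμ hvz => ?_, ?_⟩
  · simpa only [hTw] using hb
  · rw [hTw, real_inner_smul_left, hSinner]
  · exact (one_lt_inv₀ (hm0 i)).2 (hmlt i)
  · exact inv_anti₀ (hm0 k) (hanti hik)
  · refine Filter.Tendsto.inv_tendsto_nhdsGT_zero ?_
    exact tendsto_nhdsWithin_iff.2 ⟨hlim, Filter.Eventually.of_forall hm0⟩
  · have hvS : v = μ • S (T v) := by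
      refine ext_inner_right ℝ fun z => ?_
      rw [hvz, real_inner_smul_left, hSinner]
    have hμ0 : μ ≠ 0 := fun h0 => hv (by rw [hvS, h0, zero_smul])
    have hTv : T v ≠ 0 := fun h0 => hv (by rw [hvS, h0, map_zero, smul_zero])
    have hAv : A (T v) = μ⁻¹ • T v := by
      have := congrArg T hvS
      rw [map_smul] at this
      rw [eq_inv_smul_iff₀ hμ0]
      exact this.symm
    obtain ⟨i, hi⟩ := hall μ⁻¹ (fun h => hμ (inv_eq_one.1 h))
      (Module.End.hasEigenvalue_of_hasEigenvector (x := T v)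
        ⟨Module.End.mem_eigenspace_iff.2 hAv, hTv⟩)
    exact ⟨i, by simp [hi]⟩
  · simp only [hTw]
    rw [eq_top_iff, ← hcl]
    refine Submodule.topologicalClosure_mono (sup_le_sup_left (fun f hf => ?_) _)
    have hAf : A f = f := by
      have := Module.End.mem_eigenspace_iff.1 hf
      rwa [one_smul] at this
    -- A fixed vector `f` of `T S` is the image under `T` of `S f`, which solves the problem with `κ
    -- = 1`.
    refine Submodule.subset_span ⟨S f, fun z => ?_, hAf⟩
    change ⟪S f, z⟫ = ⟪A f, T z⟫
    rw [hAf, hSinner]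

end Variational

/-! ### Integrability of the kernel and energies of test functions -/

section Kernel

variable {N : ℕ} [NeZero N] {σ : ℝ}

/-- In polar coordinates the integrand is `y^(1-2σ)` near zero, integrable since `σ < 1`, and
`y^(-1-2σ)` at infinity, integrable since `σ > 0`. -/
theorem integrable_kernel (hσ₀ : 0 < σ) (hσ₁ : σ < 1) :
    Integrable fun z : RN N => min 1 (‖z‖ ^ 2) / ‖z‖ ^ ((N : ℝ) + 2 * σ) := by
  have hnt : Nontrivial (RN N) := inferInstance
  have hN : 1 ≤ N := Nat.one_le_iff_ne_zero.2 (NeZero.ne N)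
  rw [integrable_fun_norm_addHaar (volume : Measure (RN N))
    (f := fun y : ℝ => min 1 (y ^ 2) / y ^ ((N : ℝ) + 2 * σ)), finrank_euclideanSpace,
    Fintype.card_fin, ← Set.Ioc_union_Ioi_eq_Ioi zero_le_one]
  have hpow : ∀ y : ℝ, 0 < y → y ^ (N - 1) = y ^ ((N : ℝ) - 1) := fun y hy => by
    rw [← Real.rpow_natCast, Nat.cast_sub hN, Nat.cast_one]
  refine IntegrableOn.union ?_ ?_
  · have h1 : IntegrableOn (fun y : ℝ => y ^ (1 - 2 * σ)) (Set.Ioc 0 1) :=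
      (intervalIntegrable_iff_integrableOn_Ioc_of_le zero_le_one).1
        (intervalIntegral.intervalIntegrable_rpow' (by linarith))
    refine h1.congr_fun (fun y hy => ?_) measurableSet_Ioc
    have hy1 : min 1 (y ^ 2) = y ^ (2 : ℝ) := by
      rw [Real.rpow_two]; exact min_eq_right (pow_le_one₀ hy.1.le hy.2)
    simp only [smul_eq_mul]
    rw [hpow y hy.1, hy1, ← Real.rpow_sub hy.1, ← Real.rpow_add hy.1]
    congr 1
    ring
  · have h1 : IntegrableOn (fun y : ℝ => y ^ (-1 - 2 * σ)) (Set.Ioi 1) :=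
      integrableOn_Ioi_rpow_of_lt (by linarith) one_pos
    refine h1.congr_fun (fun y hy => ?_) measurableSet_Ioi
    have hy0 : (0 : ℝ) < y := one_pos.trans hy
    have hy1 : min 1 (y ^ 2) = y ^ (0 : ℝ) := by
      rw [Real.rpow_zero]; exact min_eq_left (one_le_pow₀ (le_of_lt hy))
    simp only [smul_eq_mul]
    rw [hpow y hy0, hy1, ← Real.rpow_sub hy0, ← Real.rpow_add hy0]
    congr 1
    ring

/-- Integrability matters as much as positivity: a divergent integral would count as zero and give
the constant `0`. Domination uses `1 - cos t ≤ min 2 (t²/2)`; the integrand is positive on the slab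
`0 < ξ₀ < 1`. -/
theorem cNσ_pos (hσ₀ : 0 < σ) (hσ₁ : σ < 1) : 0 < cNσ N σ := by
  rw [cNσ, inv_pos]
  have hnn : ∀ ξ : RN N, 0 ≤ (1 - Real.cos (ξ 0)) / ‖ξ‖ ^ ((N : ℝ) + 2 * σ) := fun ξ =>
    div_nonneg (sub_nonneg.2 (Real.cos_le_one _)) (Real.rpow_nonneg (norm_nonneg _) _)
  have hint : Integrable fun ξ : RN N => (1 - Real.cos (ξ 0)) / ‖ξ‖ ^ ((N : ℝ) + 2 * σ) := by
    refine ((integrable_kernel (N := N) hσ₀ hσ₁).const_mul 2).mono' ?_ ?_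
    · refine Measurable.aestronglyMeasurable ?_
      exact (measurable_const.sub (Real.measurable_cos.comp (by fun_prop))).div
        (measurable_norm.pow_const _)
    · refine Filter.Eventually.of_forall fun ξ => ?_
      rw [Real.norm_of_nonneg (hnn ξ), mul_div_assoc']
      refine div_le_div_of_nonneg_right ?_ (Real.rpow_nonneg (norm_nonneg _) _)
      have h1 := Real.one_sub_sq_div_two_le_cos (x := ξ 0)
      have h2 := Real.neg_one_le_cos (ξ 0)
      have h3 : (ξ 0) ^ 2 ≤ ‖ξ‖ ^ 2 := sq_le_sq' (by
        have := (abs_le.1 (PiLp.norm_apply_le ξ 0)).1; linarith)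
        (abs_le.1 (PiLp.norm_apply_le ξ 0)).2
      rw [mul_min_of_nonneg _ _ (by norm_num : (0 : ℝ) ≤ 2)]
      exact le_min (by linarith) (by nlinarith [sq_nonneg ‖ξ‖])
  rw [integral_pos_iff_support_of_nonneg hnn hint]
  have hopen : IsOpen {ξ : RN N | ξ 0 ∈ Set.Ioo (0 : ℝ) 1} :=
    isOpen_Ioo.preimage (by fun_prop)
  refine (hopen.measure_pos volume ⟨EuclideanSpace.single 0 (1 / 2), ?_⟩).trans_le
    (measure_mono fun ξ hξ => ?_)
  · norm_num
  · have hξ0 : ξ ≠ 0 := fun h => by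
      have := hξ.1
      simp [h] at this
    have hcos : Real.cos (ξ 0) < 1 := by
      have h1 := Real.cos_lt_cos_of_nonneg_of_le_pi_div_two le_rfl
        (by linarith [hξ.2, Real.pi_gt_three]) hξ.1
      simpa using h1
    exact (div_pos (sub_pos.2 hcos) (Real.rpow_pos_of_pos (norm_pos_iff.2 hξ0) _)).ne'

/-- The integrand is at most `k(x - y)` with `k` integrable. Since one of the points lies in `Ω`,
the energy is at most `2 |Ω| ∫ k`. -/
theorem fieldEnergy_lt_top_of_lipschitz (hσ₀ : 0 < σ) (hσ₁ : σ < 1) {Ω : Set (RN N)}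
    (hb : Bornology.IsBounded Ω) {U : RN N → RN N} {B : ℝ}
    (hlip : ∀ x y, ‖U x - U y‖ ≤ B * ‖x - y‖) (hbdd : ∀ x y, ‖U x - U y‖ ≤ B) :
    fieldEnergy σ Ω U < ⊤ := by
  set k : RN N → ℝ≥0∞ := fun z =>
    ENNReal.ofReal (B ^ 2 * (min 1 (‖z‖ ^ 2) / ‖z‖ ^ ((N : ℝ) + 2 * σ))) with hk
  have hkm : Measurable k := by
    refine Measurable.ennreal_ofReal (Measurable.const_mul ?_ _)
    exact (measurable_const.min (measurable_norm.pow_const 2)).div (measurable_norm.pow_const _)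
  have hB0 : 0 ≤ B := (norm_nonneg _).trans (hbdd 0 0)
  have hkfin : ∫⁻ z, k z < ⊤ := by
    have h := ((integrable_kernel (N := N) hσ₀ hσ₁).const_mul (B ^ 2)).lintegral_lt_top
    exact h
  have hle : ∀ z : RN N × RN N, ‖gagliardoDiff σ U z‖ₑ ^ 2 ≤ k (z.1 - z.2) := fun z => by
    rw [enorm_gagliardoDiff_sq, hk]
    refine ENNReal.ofReal_le_ofReal ?_
    rw [mul_div_assoc']
    refine div_le_div_of_nonneg_right ?_ (Real.rpow_nonneg (norm_nonneg _) _)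
    rw [mul_min_of_nonneg _ _ (sq_nonneg B), mul_one, ← mul_pow]
    exact le_min (pow_le_pow_left₀ (norm_nonneg _) (hbdd _ _) 2)
      (pow_le_pow_left₀ (norm_nonneg _) (hlip _ _) 2)
  have hcov : Qset Ω ⊆ Ω ×ˢ Set.univ ∪ Set.univ ×ˢ Ω := fun z hz => by
    by_contra hcon
    simp only [Set.mem_union, Set.mem_prod, Set.mem_univ, and_true, true_and, not_or] at hcon
    exact hz ⟨hcon.1, hcon.2⟩
  have hkm2 : Measurable fun z : RN N × RN N => k (z.1 - z.2) :=
    hkm.comp (measurable_fst.sub measurable_snd)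
  have hvol : volume Ω < ⊤ := hb.measure_lt_top
  rw [fieldEnergy, qMeasure]
  calc _ ≤ ∫⁻ z in Ω ×ˢ Set.univ ∪ Set.univ ×ˢ Ω, k (z.1 - z.2)
          ∂((volume : Measure (RN N)).prod volume) :=
        (lintegral_mono hle).trans (lintegral_mono_set hcov)
    _ ≤ _ := lintegral_union_le _ _ _
    _ = volume Ω * (∫⁻ z, k z) + volume Ω * (∫⁻ z, k z) := by
        congr 1
        · rw [← Measure.prod_restrict, Measure.restrict_univ,
            lintegral_prod _ hkm2.aemeasurable]
          simp only [lintegral_sub_left_eq_self k]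
          rw [setLIntegral_const, mul_comm]
        · rw [← Measure.prod_restrict, Measure.restrict_univ,
            lintegral_prod_symm _ hkm2.aemeasurable]
          simp only [lintegral_sub_right_eq_self k]
          rw [setLIntegral_const, mul_comm]
    _ < ⊤ := by finiteness

theorem memHsN_of_contDiff (hσ₀ : 0 < σ) (hσ₁ : σ < 1) {Ω : Set (RN N)}
    (hb : Bornology.IsBounded Ω) {φ : RN N → ℝ} (hφ : ContDiff ℝ ∞ φ)
    (hc : HasCompactSupport φ) : MemHsN σ Ω 0 φ := by
  have hg := hasWeakGradient_of_contDiff hφ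
  have hfc : Continuous (fderiv ℝ φ) := hφ.continuous_fderiv (by simp)
  obtain ⟨B, hB⟩ := (hc.fderiv ℝ).exists_bound_of_continuous hfc
  obtain ⟨K, hK⟩ := ContDiff.lipschitzWith_of_hasCompactSupport (hc.fderiv ℝ)
    (hφ.fderiv_right (m := ∞) (by simp)) (by simp)
  have hdiff : ∀ x y, ‖gradient φ x - gradient φ y‖ = ‖fderiv ℝ φ x - fderiv ℝ φ y‖ :=
    fun x y => by rw [gradient, gradient, ← map_sub, LinearIsometryEquiv.norm_map]
  have hB0 : 0 ≤ B := (norm_nonneg _).trans (hB 0)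
  refine ⟨⟨_, hg⟩, ?_, ?_, by simp⟩
  · rw [energy_eq hg]
    -- `K` is a Lipschitz constant of the gradient and `2 * B` bounds its oscillation.
    refine fieldEnergy_lt_top_of_lipschitz hσ₀ hσ₁ hb (B := max K (2 * B)) (fun x y => ?_)
      fun x y => ?_
    · rw [hdiff]
      have h1 := hK.dist_le_mul x y
      rw [dist_eq_norm, dist_eq_norm] at h1
      exact h1.trans (mul_le_mul_of_nonneg_right (le_max_left _ _) (norm_nonneg _))
    · rw [hdiff]
      refine le_trans ?_ (le_max_right _ _)
      linarith [norm_sub_le (fderiv ℝ φ x) (fderiv ℝ φ y), hB x, hB y]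
  · exact (hφ.continuous.memLp_of_hasCompactSupport hc).restrict Ω

end Kernel

/-! ### The Neumann problem in Hilbert space form -/

section EigenvalueProblem

variable {N : ℕ} {σ : ℝ} {Ω : Set (RN N)} {u v : RN N → ℝ} {U V : RN N → RN N}

theorem isFiniteMeasure_restrict_of_isBounded (hb : Bornology.IsBounded Ω) :
    IsFiniteMeasure ((volume : Measure (RN N)).restrict Ω) :=
  ⟨by rw [Measure.restrict_apply_univ]; exact hb.measure_lt_top⟩

/-- An infinite Hausdorff space has infinitely many disjoint nonempty open subsets; their indicators
are nonzero and orthogonal. -/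
theorem not_finiteDimensional_L2 [NeZero N] (hΩ : IsOpen Ω) (hne : Ω.Nonempty)
    (hb : Bornology.IsBounded Ω) : ¬ FiniteDimensional ℝ (Lp ℝ 2 (volume.restrict Ω)) := by
  have hinf : Infinite Ω := by
    obtain ⟨x, hx⟩ := hne
    have hnt : Nontrivial (RN N) := inferInstance
    exact (infinite_of_mem_nhds x (hΩ.mem_nhds hx)).to_subtype
  obtain ⟨W, hWi, hWo, hd⟩ := exists_seq_infinite_isOpen_pairwise_disjoint Ω
  have hW' : ∀ n, IsOpen ((↑) '' W n : Set (RN N)) := fun n => hΩ.isOpenMap_subtype_val _ (hWo n)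
  have hfin := isFiniteMeasure_restrict_of_isBounded hb
  set f : ℕ → Lp ℝ 2 (volume.restrict Ω) := fun n =>
    indicatorConstLp 2 (hW' n).measurableSet (measure_ne_top _ _) (1 : ℝ) with hf
  have hpos : ∀ n, 0 < (volume : Measure (RN N)).restrict Ω ((↑) '' W n : Set (RN N)) := fun n => by
    rw [Measure.restrict_apply (hW' n).measurableSet,
      Set.inter_eq_left.2 (Subtype.coe_image_subset _ _)]
    exact (hW' n).measure_pos volume ((hWi n).nonempty.image _)
  have horth : Pairwise fun n k => ⟪f n, f k⟫ = 0 := fun n k hnk => by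
    have hdis : Disjoint ((↑) '' W n : Set (RN N)) ((↑) '' W k) :=
      (Set.disjoint_image_iff Subtype.val_injective).2 (hd hnk)
    change ⟪f n, f k⟫ = 0
    simp only [hf]
    rw [L2.inner_indicatorConstLp_eq_setIntegral_inner]
    rw [setIntegral_congr_ae (g := fun _ => (0 : ℝ)) (hW' n).measurableSet]
    · simp
    · filter_upwards [indicatorConstLp_coeFn (p := 2) (hs := (hW' k).measurableSet)
        (hμs := measure_ne_top ((volume : Measure (RN N)).restrict Ω) _) (c := (1 : ℝ))] with x hx hxn
      rw [hx, Set.indicator_of_notMem (Set.disjoint_left.1 hdis hxn), inner_zero_right]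
  have hne0 : ∀ n, f n ≠ 0 := fun n h0 => by
    have h1 := congrArg norm h0
    rw [hf, norm_indicatorConstLp two_ne_zero ENNReal.ofNat_ne_top, norm_zero] at h1
    have h2 : 0 < ((volume : Measure (RN N)).restrict Ω).real ((↑) '' W n : Set (RN N)) :=
      ENNReal.toReal_pos (hpos n).ne' (measure_ne_top _ _)
    have h3 := Real.rpow_pos_of_pos h2 (1 / (2 : ℝ≥0∞).toReal)
    rw [norm_one, one_mul] at h1
    exact h3.ne' h1
  intro hfd
  have := (linearIndependent_of_ne_zero_of_inner_eq_zero (𝕜 := ℝ) hne0 horth).finite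
  exact not_finite ℕ

theorem inner_L2_eq (f g : Lp ℝ 2 (volume.restrict Ω)) {a b : RN N → ℝ}
    (hf : f =ᵐ[volume.restrict Ω] a) (hg : g =ᵐ[volume.restrict Ω] b) :
    ⟪f, g⟫ = ∫ x in Ω, a x * b x := by
  rw [L2.inner_def]
  refine integral_congr_ae ?_
  filter_upwards [hf, hg] with x hx hx'
  rw [hx, hx']
  simp [mul_comm]

/-- Density of the range: test functions belong to the energy space, so `f` is annihilated by all of
them. -/
theorem eq_zero_of_inner_energyEmbedding [NeZero N] (hσ₀ : 0 < σ) (hσ₁ : σ < 1)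
    (hb : Bornology.IsBounded Ω) (f : Lp ℝ 2 (volume.restrict Ω))
    (h : ∀ w, ⟪energyEmbedding σ Ω w, f⟫ = 0) : f = 0 := by
  have hfin := isFiniteMeasure_restrict_of_isBounded hb
  rw [Lp.eq_zero_iff_ae_eq_zero]
  refine ae_eq_zero_of_integral_contDiff_smul_eq_zero
    ((Lp.memLp f).integrable (by norm_num)).locallyIntegrable fun φ hφ hc => ?_
  obtain ⟨w, hw⟩ := (memHsN_of_contDiff hσ₀ hσ₁ hb hφ hc).exists_represents
  have h1 := h ⟨w, _, _, hw⟩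
  rwa [inner_L2_eq _ _ (energyEmbedding_ae (w := ⟨w, _, _, hw⟩) hw) (ae_eq_refl _)] at h1

theorem norm_energyEmbedding_le (w : energySpace σ Ω) : ‖energyEmbedding σ Ω w‖ ≤ ‖w‖ := by
  have h := WithLp.prod_norm_sq_eq_of_L2 (w : EnergyTarget Ω)
  have h1 : ‖energyEmbedding σ Ω w‖ ^ 2 ≤ ‖w‖ ^ 2 := by
    rw [Submodule.coe_norm, h]
    exact le_add_of_nonneg_right (sq_nonneg _)
  exact (pow_le_pow_iff_left₀ (norm_nonneg _) (norm_nonneg _) two_ne_zero).1 h1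

theorem inner_energySpace {w z : energySpace σ Ω} (hw : Represents σ Ω w u U)
    (hz : Represents σ Ω z v V) :
    ⟪w, z⟫ = ⟪energyEmbedding σ Ω w, energyEmbedding σ Ω z⟫ + energyForm σ Ω u v := by
  rw [Submodule.coe_inner, WithLp.prod_inner_apply, energyForm_eq hw.weakGrad hz.weakGrad]
  congr 1
  rw [L2.inner_def]
  refine integral_congr_ae ?_
  filter_upwards [hw.snd, hz.snd] with x hx hx'
  exact congrArg₂ _ hx hx'

theorem Represents.congr {w : EnergyTarget Ω} (hw : Represents σ Ω w u U) (h : u =ᵐ[volume] v)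
    (h' : U =ᵐ[volume] V) : Represents σ Ω w v V where
  weakGrad := hw.weakGrad.congr h h'
  fst := hw.fst.trans (ae_restrict_of_ae h)
  snd := hw.snd.trans (ae_restrict_of_ae (gagliardoDiff_congr h'))

/-- The energy norm controls `u` on every ball, so the zero vector represents only functions
vanishing a.e. on the whole space, not merely on `Ω`. -/
theorem Represents.eq_zero_iff {w : EnergyTarget Ω} (hw : Represents σ Ω w u U) (hσ : 0 < σ)
    (hΩ : IsOpen Ω) (hne : Ω.Nonempty) (hb : Bornology.IsBounded Ω) :
    w = 0 ↔ u =ᵐ[volume] 0 := by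
  constructor
  · intro h0
    obtain ⟨R₀, hR₀⟩ := hb.subset_ball (0 : RN N)
    refine ae_eq_const_of_lintegral_zero hw.weakGrad.locInt.aestronglyMeasurable (m := (0 : ℝ))
      (R₀ := R₀)
      fun R hR => le_antisymm ?_ bot_le
    obtain ⟨C, hC, hbound⟩ := exists_lintegral_le hσ hΩ hne
      (hR₀.trans (Metric.ball_subset_ball hR))
    have := hbound hw.weakGrad
    rw [← hw.enorm_sq, h0] at this
    simpa using this
  · intro h0
    have h1 : HasWeakGradient (0 : RN N → ℝ) 0 := by
      have := hasWeakGradient_affine (N := N) 0 0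
      simpa using! this
    have hU := hw.weakGrad.ae_unique h1 h0
    have h2 := (hw.congr h0 hU).enorm_sq
    have h3 : gagliardoDiff σ (0 : RN N → RN N) = 0 := by ext1 z; simp [gagliardoDiff]
    simpa [fieldEnergy, h3] using h2

/-- The weak form of the eigenvalue problem, in the Hilbert space `energySpace σ Ω`. -/
theorem isNeumannEigenfunction_iff [NeZero N] (hσ₀ : 0 < σ) (hσ₁ : σ < 1) (hΩ : IsOpen Ω)
    (hne : Ω.Nonempty) (hb : Bornology.IsBounded Ω) {w : energySpace σ Ω}
    (hw : Represents σ Ω w u U) {μ κ : ℝ} (hκ : μ = cNσ N σ / 2 * (κ - 1)) :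
    IsNeumannEigenfunction σ Ω μ u ↔ w ≠ 0 ∧
      ∀ z, ⟪w, z⟫ = κ * ⟪energyEmbedding σ Ω w, energyEmbedding σ Ω z⟫ := by
  have hc := cNσ_pos (N := N) hσ₀ hσ₁
  have hzero : w ≠ 0 ↔ ¬ u =ᵐ[volume] 0 := by
    rw [← hw.eq_zero_iff hσ₀ hΩ hne hb, ne_eq, ← Submodule.coe_eq_zero]
  have hmem := hw.memHsN
  -- Adding `∫_Ω u v` to the energy form gives the inner product, whence the shift `κ - 1`. The
  -- exterior and boundary terms vanish because their data are zero.
  have key : ∀ {z : energySpace σ Ω} {v : RN N → ℝ} {V : RN N → RN N},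
      Represents σ Ω z v V →
      ((cNσ N σ / 2 * energyForm σ Ω u v =
        (∫ x in Ω, (μ * u x) * v x) + (∫ x in Ωᶜ, (0 : RN N → ℝ) x * v x) +
          ∫ x, (0 : RN N → ℝ) x * boundaryTrace Ω v x ∂(surfaceMeasure Ω)) ↔
        ⟪w, z⟫ = κ * ⟪energyEmbedding σ Ω w, energyEmbedding σ Ω z⟫) := fun {z v V} hz => by
    have h1 : ∫ x in Ω, (μ * u x) * v x =
        μ * ⟪energyEmbedding σ Ω w, energyEmbedding σ Ω z⟫ := by
      rw [inner_L2_eq _ _ (energyEmbedding_ae hw) (energyEmbedding_ae hz), ← integral_const_mul]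
      simp only [mul_assoc]
    rw [h1, inner_energySpace hw hz, hκ]
    simp only [Pi.zero_apply, zero_mul, integral_zero, add_zero]
    constructor
    · intro h
      rw [mul_assoc] at h
      have := mul_left_cancel₀ (by positivity : cNσ N σ / 2 ≠ 0) h
      rw [this]; ring
    · intro h
      have : energyForm σ Ω u v = (κ - 1) * ⟪energyEmbedding σ Ω w, energyEmbedding σ Ω z⟫ := by
        linarith
      rw [this]; ring
  rw [IsNeumannEigenfunction, IsWeakSolution, hzero]
  constructor
  · rintro ⟨⟨-, h⟩, h0⟩
    refine ⟨h0, fun z => ?_⟩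
    obtain ⟨v, V, hz⟩ := z.2
    exact (key hz).1 (h v hz.memHsN)
  · rintro ⟨h0, h⟩
    refine ⟨⟨hmem, fun v hv => ?_⟩, h0⟩
    obtain ⟨z, hz⟩ := hv.exists_represents
    exact (key (z := ⟨z, _, _, hz⟩) hz).2 (h _)

/-- Testing with `z = w` leaves no room for the second component, so the energy vanishes. -/
theorem Represents.exists_affine {w : energySpace σ Ω} (hw : Represents σ Ω w u U) (hσ : 0 < σ)
    (hΩ : IsOpen Ω) (hne : Ω.Nonempty) (hb : Bornology.IsBounded Ω)
    (h : ∀ z, ⟪w, z⟫ = ⟪energyEmbedding σ Ω w, energyEmbedding σ Ω z⟫) :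
    ∃ q, IsAffineFunction q ∧ u =ᵐ[volume] q := by
  refine hw.weakGrad.exists_affine hσ hΩ hne hb ?_
  have h1 : (w : EnergyTarget Ω).snd = 0 := by
    have h2 := h w
    rw [real_inner_self_eq_norm_sq, real_inner_self_eq_norm_sq, Submodule.coe_norm,
      WithLp.prod_norm_sq_eq_of_L2] at h2
    have h3 : ‖(w : EnergyTarget Ω).snd‖ ^ 2 = 0 := add_eq_left.1 h2
    simpa using h3
  have h2 := hw.snd
  rw [h1] at h2
  rw [fieldEnergy, lintegral_congr_ae (g := fun _ => 0), lintegral_zero]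
  filter_upwards [h2, Lp.coeFn_zero (RN N) 2 (qMeasure Ω)] with z hz hz'
  rw [← hz, hz']
  simp

theorem memLp_affine (hb : Bornology.IsBounded Ω) (q : ℝ × RN N) :
    MemLp (fun x => q.1 + ⟪q.2, x⟫) 2 (volume.restrict Ω) := by
  have hfin := isFiniteMeasure_restrict_of_isBounded hb
  obtain ⟨R, hR⟩ := hb.subset_ball (0 : RN N)
  have hcont : Continuous fun x : RN N => q.1 + ⟪q.2, x⟫ := by fun_prop
  refine MemLp.mono_measure (Measure.restrict_mono hR le_rfl) ?_
  have : IsFiniteMeasure ((volume : Measure (RN N)).restrict (Metric.ball 0 R)) :=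
    isFiniteMeasure_restrict_of_isBounded Metric.isBounded_ball
  refine MemLp.of_bound hcont.aestronglyMeasurable (|q.1| + ‖q.2‖ * R) ?_
  filter_upwards [ae_restrict_mem Metric.isOpen_ball.measurableSet] with x hx
  rw [mem_ball_zero_iff] at hx
  refine (norm_add_le _ _).trans (add_le_add le_rfl ((norm_inner_le_norm _ _).trans ?_))
  exact mul_le_mul_of_nonneg_left hx.le (norm_nonneg _)

/-- Affine functions, restricted to `Ω`, as elements of `L²(Ω)`. -/
noncomputable def affineEmbedding (hb : Bornology.IsBounded Ω) :
    (ℝ × RN N) →ₗ[ℝ] Lp ℝ 2 (volume.restrict Ω) where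
  toFun q := (memLp_affine hb q).toLp
  map_add' q q' := by
    rw [← MemLp.toLp_add]
    congr 1
    ext x
    simp only [Prod.fst_add, Prod.snd_add, inner_add_left, Pi.add_apply]
    ring
  map_smul' a q := by
    rw [RingHom.id_apply, ← MemLp.toLp_const_smul]
    congr 1
    ext x
    simp [real_inner_smul_left, mul_add]

theorem affineEmbedding_ae (hb : Bornology.IsBounded Ω) (q : ℝ × RN N) :
    affineEmbedding hb q =ᵐ[volume.restrict Ω] fun x => q.1 + ⟪q.2, x⟫ :=
  (memLp_affine hb q).coeFn_toLp

/-- By continuity the affine function vanishes everywhere on `Ω`, but it would strictly increase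
along its own gradient from a point of `Ω`. -/
theorem affineEmbedding_injective (hΩ : IsOpen Ω) (hne : Ω.Nonempty)
    (hb : Bornology.IsBounded Ω) :
    Function.Injective (affineEmbedding hb) := by
  rw [injective_iff_map_eq_zero]
  intro q hq
  have h1 : (fun x : RN N => q.1 + ⟪q.2, x⟫) =ᵐ[volume.restrict Ω] fun _ => 0 := by
    refine (affineEmbedding_ae hb q).symm.trans ?_
    rw [hq]
    exact Lp.coeFn_zero _ _ _
  have h2 : Set.EqOn (fun x : RN N => q.1 + ⟪q.2, x⟫) (fun _ => 0) Ω :=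
    Measure.eqOn_open_of_ae_eq h1 hΩ (by fun_prop) (by fun_prop)
  obtain ⟨x, hx⟩ := hne
  have hq2 : q.2 = 0 := by
    by_contra hq2
    have hlim : Tendsto (fun t : ℝ => x + t • q.2) (𝓝[>] 0) (𝓝 x) := by
      have : Continuous fun t : ℝ => x + t • q.2 := by fun_prop
      have h := this.tendsto 0
      rw [zero_smul, add_zero] at h
      exact h.mono_left nhdsWithin_le_nhds
    obtain ⟨t, ht, ht0⟩ := ((hlim.eventually (hΩ.mem_nhds hx)).and self_mem_nhdsWithin).exists
    have h3 := h2 ht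
    have h4 := h2 hx
    simp only [inner_add_right, real_inner_smul_right, real_inner_self_eq_norm_sq] at h3 h4
    have h5 : 0 < t * ‖q.2‖ ^ 2 := mul_pos ht0 (by positivity)
    linarith
  have h3 := h2 hx
  simp only [hq2, inner_zero_left, add_zero] at h3
  exact Prod.ext h3 hq2

/-- A constant gradient has zero differences, so only the `L²(Ω)` component survives and the
variational equation holds with `κ = 1`. -/
theorem exists_represents_affine (σ : ℝ) (hb : Bornology.IsBounded Ω) (q : ℝ × RN N) :
    ∃ w : energySpace σ Ω, Represents σ Ω w (fun x => q.1 + ⟪q.2, x⟫) (fun _ => q.2) ∧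
      energyEmbedding σ Ω w = affineEmbedding hb q ∧
      ∀ z, ⟪w, z⟫ = ⟪energyEmbedding σ Ω w, energyEmbedding σ Ω z⟫ := by
  have hg := hasWeakGradient_affine (N := N) q.1 q.2
  have h0 : gagliardoDiff σ (fun _ : RN N => q.2) = 0 := by ext1 z; simp [gagliardoDiff]
  have hrep : Represents σ Ω (WithLp.toLp 2 (affineEmbedding hb q, 0))
      (fun x => q.1 + ⟪q.2, x⟫) (fun _ => q.2) := by
    refine ⟨hg, affineEmbedding_ae hb q, ?_⟩
    rw [h0]
    exact Lp.coeFn_zero _ _ _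
  refine ⟨⟨_, _, _, hrep⟩, hrep, rfl, fun z => ?_⟩
  obtain ⟨v, V, hz⟩ := z.2
  rw [inner_energySpace (w := ⟨_, _, _, hrep⟩) hrep hz, energyForm_eq hg hz.weakGrad, h0]
  simp

end EigenvalueProblem

/-! ### Affine and higher eigenfunctions as one orthogonal system -/

section CompleteSystem

variable {N : ℕ} {Ω : Set (RN N)}

/-- Orthonormality is meant in `L²(Ω)`; the count `N + 1` is the dimension of `ℝ × ℝ^N`, preserved
by injectivity. -/
theorem exists_affine_orthonormal (hΩ : IsOpen Ω) (hne : Ω.Nonempty)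
    (hb : Bornology.IsBounded Ω) :
    ∃ q : Fin (N + 1) → ℝ × RN N, Orthonormal ℝ (fun j => affineEmbedding hb (q j)) ∧
      ∀ c, affineEmbedding hb c ∈ Submodule.span ℝ (Set.range fun j => affineEmbedding hb (q j)) := by
  have hfin : Module.finrank ℝ (LinearMap.range (affineEmbedding hb)) = N + 1 := by
    rw [LinearMap.finrank_range_of_inj (affineEmbedding_injective hΩ hne hb),
      Module.finrank_prod, Module.finrank_self, finrank_euclideanSpace, Fintype.card_fin, add_comm]
  obtain ⟨b⟩ : Nonempty (OrthonormalBasis (Fin (N + 1)) ℝ (LinearMap.range (affineEmbedding hb))) :=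
    ⟨(stdOrthonormalBasis ℝ _).reindex (finCongr hfin)⟩
  choose q hq using fun j => (b j).2
  refine ⟨q, ?_, fun c => ?_⟩
  · simp only [hq]
    exact b.orthonormal.comp_linearIsometry (LinearMap.range (affineEmbedding hb)).subtypeₗᵢ
  · have h1 := congrArg Subtype.val (b.sum_repr ⟨_, LinearMap.mem_range_self _ c⟩)
    simp only [Submodule.coe_sum, Submodule.coe_smul] at h1
    rw [← h1]
    exact Submodule.sum_mem _ fun j _ => Submodule.smul_mem _ _
      (Submodule.subset_span ⟨j, hq j⟩)

theorem isCompleteOrthogonalSystem_sumElim {ι κ : Type*} {f : ι → Lp ℝ 2 (volume.restrict Ω)}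
    {g : κ → Lp ℝ 2 (volume.restrict Ω)} {p : ι → RN N → ℝ} {u : κ → RN N → ℝ}
    (hp : ∀ i, f i =ᵐ[volume.restrict Ω] p i) (hu : ∀ i, g i =ᵐ[volume.restrict Ω] u i)
    (hf : Orthonormal ℝ f) (hg : Orthonormal ℝ g) (hfg : ∀ i k, ⟪f i, g k⟫ = 0)
    (hd : (Submodule.span ℝ (Set.range g) ⊔
      Submodule.span ℝ (Set.range f)).topologicalClosure = ⊤) :
    IsCompleteOrthogonalSystem Ω (Sum.elim p u) := by
  set F : ι ⊕ κ → Lp ℝ 2 (volume.restrict Ω) := Sum.elim f g with hF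
  have hae : ∀ i, F i =ᵐ[volume.restrict Ω] Sum.elim p u i := fun i => by
    cases i with
    | inl i => exact hp i
    | inr i => exact hu i
  have hw : ∀ i, MemLp (Sum.elim p u i) 2 (volume.restrict Ω) := fun i =>
    (memLp_congr_ae (hae i)).1 (Lp.memLp _)
  have hl : ∀ i, (hw i).toLp = F i := fun i =>
    Lp.ext ((hw i).coeFn_toLp.trans (hae i).symm)
  refine ⟨hw, fun i => ?_, fun i k hik => ?_, ?_⟩
  · rw [hl]
    cases i with
    | inl i => exact hf.ne_zero i
    | inr i => exact hg.ne_zero i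
  · simp only [hl]
    rcases i with i | i <;> rcases k with k | k
    · exact hf.2 fun h => hik (congrArg _ h)
    · exact hfg i k
    · exact (real_inner_comm _ _).trans (hfg k i)
    · exact hg.2 fun h => hik (congrArg _ h)
  · simp only [hl]
    rw [show (fun i => F i) = Sum.elim f g from rfl, Set.Sum.elim_range,
      Submodule.span_union, sup_comm, hd]

end CompleteSystem

/-! ### The spectrum of the Neumann problem -/

theorem theorem5p1 (N : ℕ) [NeZero N] (σ : ℝ) (hσ₀ : 0 < σ) (hσ₁ : σ < 1)
    (Ω : Set (RN N)) (hΩ : IsC11Domain Ω) (hbdd : Bornology.IsBounded Ω) :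
    -- `lam i` is the eigenvalue `λ_{i+1}`, and `u i` is an eigenfunction for `λ_{i+2}`
    ∃ (lam : ℕ → ℝ) (p : Fin (N + 1) → RN N → ℝ) (u : ℕ → RN N → ℝ),
      lam 0 = 0 ∧ lam 0 < lam 1 ∧ Monotone lam ∧ Tendsto lam atTop atTop ∧
      (∀ μ : ℝ, IsNeumannEigenvalue σ Ω μ ↔ ∃ i, lam i = μ) ∧
      (∀ w : RN N → ℝ, IsNeumannEigenfunction σ Ω (lam 0) w ↔
        (¬ w =ᵐ[volume] 0 ∧ ∃ q, IsAffineFunction q ∧ w =ᵐ[volume] q)) ∧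
      (∀ j, IsAffineFunction (p j) ∧ IsNeumannEigenfunction σ Ω (lam 0) (p j)) ∧
      (∀ i, IsNeumannEigenfunction σ Ω (lam (i + 1)) (u i)) ∧
      IsCompleteOrthogonalSystem Ω (Sum.elim p u) := by
  have hO := hΩ.isOpen
  have hne := hΩ.isConnected.nonempty
  have hc := cNσ_pos (N := N) hσ₀ hσ₁
  have : CompleteSpace (energySpace σ Ω) :=
    (isClosed_energySpace hσ₀ hO hne hbdd).completeSpace_coe
  obtain ⟨κ, w, horth, hvar, hκ1, hκm, hκlim, hκall, hdense⟩ :=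
    exists_variational_eigenbasis (energyEmbedding σ Ω)
      (isCompactOperator_energyEmbedding hσ₀ hO hne hbdd)
      (eq_zero_of_inner_energyEmbedding hσ₀ hσ₁ hbdd) (not_finiteDimensional_L2 hO hne hbdd)
      norm_energyEmbedding_le
  choose u U hrep using fun i => (w i).2
  choose wq hwq hwqL hwqvar using exists_represents_affine σ hbdd
  obtain ⟨q, hq, hqspan⟩ := exists_affine_orthonormal hO hne hbdd
  -- Zero is listed once although its eigenspace has dimension `N + 1`; the values `κ i > 1` are
  -- shifted by one index and give the positive eigenvalues.
  obtain ⟨lam, hlam0, hlamS⟩ : ∃ lam : ℕ → ℝ, lam 0 = 0 ∧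
      ∀ i, lam (i + 1) = cNσ N σ / 2 * (κ i - 1) :=
    ⟨fun i => Nat.casesOn i 0 fun k => cNσ N σ / 2 * (κ k - 1), rfl, fun _ => rfl⟩
  have hlampos : ∀ i, 0 < lam (i + 1) := fun i => by
    rw [hlamS]; exact mul_pos (by positivity) (sub_pos.2 (hκ1 i))
  have hwne : ∀ i, w i ≠ 0 := fun i h0 => horth.ne_zero i (by simp only [h0, map_zero])
  have hu : ∀ i, IsNeumannEigenfunction σ Ω (lam (i + 1)) (u i) := fun i =>
    (isNeumannEigenfunction_iff hσ₀ hσ₁ hO hne hbdd (hrep i) (hlamS i)).2 ⟨hwne i, hvar i⟩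
  have haff : ∀ c : ℝ × RN N, wq c ≠ 0 →
      IsNeumannEigenfunction σ Ω (lam 0) fun x => c.1 + ⟪c.2, x⟫ := fun c hc0 =>
    (isNeumannEigenfunction_iff hσ₀ hσ₁ hO hne hbdd (hwq c) (κ := 1)
      (by rw [hlam0]; ring)).2 ⟨hc0, fun z => by rw [one_mul]; exact hwqvar c z⟩
  have hp : ∀ j, IsNeumannEigenfunction σ Ω (lam 0) fun x => (q j).1 + ⟪(q j).2, x⟫ := fun j =>
    haff _ fun h0 => hq.ne_zero j (by simp only [← hwqL, h0, map_zero])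
  refine ⟨lam, fun j x => (q j).1 + ⟪(q j).2, x⟫, u, hlam0, by rw [hlam0]; exact hlampos 0,
    ?_, ?_, fun μ => ⟨?_, ?_⟩, fun v => ⟨fun hv => ⟨hv.2, ?_⟩, ?_⟩,
    fun j => ⟨⟨_, _, fun _ => rfl⟩, hp j⟩, hu, ?_⟩
  · refine monotone_nat_of_le_succ fun i => ?_
    cases i with
    | zero => exact hlam0.trans_le (hlampos 0).le
    | succ i =>
      rw [hlamS, hlamS]
      have := hκm (Nat.le_succ i)
      gcongr
  · refine (tendsto_add_atTop_iff_nat 1).1 ?_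
    simp only [hlamS]
    exact (tendsto_atTop_add_const_right _ (-1) hκlim).const_mul_atTop (by positivity)
  · rintro ⟨v, hv⟩
    obtain ⟨z, hz⟩ := hv.1.1.exists_represents
    -- The relation between `μ` and `κ` solved for `κ`, possible because `c_{N,σ}` is not zero.
    have hμ : μ = cNσ N σ / 2 * ((1 + 2 * μ / cNσ N σ) - 1) := by field_simp; ring
    obtain ⟨hz0, hzvar⟩ := (isNeumannEigenfunction_iff hσ₀ hσ₁ hO hne hbdd
      (w := ⟨z, _, _, hz⟩) hz hμ).1 hv
    by_cases h1 : 1 + 2 * μ / cNσ N σ = 1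
    · exact ⟨0, by rw [hlam0, hμ, h1]; ring⟩
    · obtain ⟨i, hi⟩ := hκall _ hz0 _ h1 hzvar
      exact ⟨i + 1, by rw [hlamS, hi, ← hμ]⟩
  · rintro ⟨i, rfl⟩
    cases i with
    | zero => exact ⟨_, hp 0⟩
    | succ i => exact ⟨_, hu i⟩
  · obtain ⟨z, hz⟩ := hv.1.1.exists_represents
    obtain ⟨-, hzvar⟩ := (isNeumannEigenfunction_iff hσ₀ hσ₁ hO hne hbdd
      (w := ⟨z, _, _, hz⟩) hz (κ := 1) (by rw [hlam0]; ring)).1 hv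
    exact Represents.exists_affine (w := ⟨z, _, _, hz⟩) hz hσ₀ hO hne hbdd fun y => by
      rw [hzvar y, one_mul]
  · rintro ⟨hv0, f, ⟨c₀, c, hf⟩, hvf⟩
    have hf' : f = fun x => c₀ + ⟪c, x⟫ := funext hf
    rw [hf'] at hvf
    -- The function is affine only a.e., so the vector of the affine function is reused to represent
    -- it.
    have hz := (hwq (c₀, c)).congr hvf.symm (ae_eq_refl _)
    refine (isNeumannEigenfunction_iff hσ₀ hσ₁ hO hne hbdd hz (κ := 1)
      (by rw [hlam0]; ring)).2 ⟨fun h0 => hv0 ?_, fun y => by rw [one_mul]; exact hwqvar _ y⟩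
    exact (hz.eq_zero_iff hσ₀ hO hne hbdd).1 (by rw [h0]; rfl)
  · refine isCompleteOrthogonalSystem_sumElim (fun j => affineEmbedding_ae hbdd (q j))
      (fun i => energyEmbedding_ae (hrep i)) hq horth (fun j i => ?_) ?_
    · rw [← hwqL]
      -- Solutions with different `κ`, here `1` and `κ i > 1`, have orthogonal restrictions.
      exact inner_eq_zero_of_variational (κ := 1)
        (fun z => by rw [one_mul]; exact hwqvar _ z) (hvar i) (hκ1 i).ne
    -- The abstract density statement involves all solutions with `κ = 1`; these are affine, hence
    -- lie in the span of the chosen `N + 1`.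
    · rw [eq_top_iff, ← hdense]
      refine Submodule.topologicalClosure_mono (sup_le_sup_left (Submodule.span_le.2 ?_) _)
      rintro _ ⟨z, hz, rfl⟩
      obtain ⟨v, V, hzrep⟩ := z.2
      obtain ⟨f, ⟨c₀, c, hf⟩, hvf⟩ := hzrep.exists_affine hσ₀ hO hne hbdd hz
      have hzA : energyEmbedding σ Ω z = affineEmbedding hbdd (c₀, c) := by
        have hvf' : v =ᵐ[volume.restrict Ω] f := ae_restrict_of_ae hvf
        refine Lp.ext ((energyEmbedding_ae hzrep).trans (hvf'.trans ?_))
        rw [show f = fun x => c₀ + ⟪c, x⟫ from funext hf]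
        exact (affineEmbedding_ae hbdd (c₀, c)).symm
      rw [hzA]
      exact hqspan _
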